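/- Let $H_0,K_0$ be complex Hilbert spaces and let $\mathcal A\subseteq B(H_0)$, $\mathcal B\subseteq B(K_0)$ be $w^*$-closed algebras of operators containing the identity operators. Write $[\mathcal S]^{-w^*}$ for the $w^*$-closure of the linear span of $\mathcal S$ and $\Delta(\mathcal A)=\mathcal A\cap\mathcal A^*$. Assume that $\mathcal A$ and $\mathcal B$ are TRO equivalent, and let $\mathcal M\subseteq B(H_0,K_0)$ be a TRO (a linear subspace with $\mathcal M\mathcal M^*\mathcal M\subseteq\mathcal M$) implementing the equivalence, i.e. $\mathcal A=[\mathcal M^*\mathcal B\mathcal M]^{-w^*}$ and $\mathcal B=[\mathcal M\mathcal A\mathcal M^*]^{-w^*}$. Put $\mathcal U=[\mathcal B\mathcal M]^{-w^*}$ and $\mathcal V=[\mathcal M^*\mathcal B]^{-w^*}$; then $\mathcal V\mathcal U\subseteq\mathcal A$. Let ${}_{\mathcal A}\mathfrak M$ be the category whose objects are the normal representations $(H,\alpha)$ of $\mathcal A$ (a Hilbert space $H$ with a unital completely contractive $w^*$-continuous homomorphism $\alpha:\mathcal A\to B(H)$) and whose morphisms $(H_1,\alpha_1)\to(H_2,\alpha_2)$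 are the operators $T\in B(H_1,H_2)$ with $T\alpha_1(A)=\alpha_2(A)T$ for all $A\in\mathcal A$. Let ${}_{\mathcal A}\mathfrak{DM}$ be the category with the same objects in which this relation is required only for $A\in\Delta(\mathcal A)$; if $T$ is a morphism of ${}_{\mathcal A}\mathfrak{DM}$, so is its adjoint $T^*$. Define ${}_{\mathcal B}\mathfrak M$ and ${}_{\mathcal B}\mathfrak{DM}$ in the same way. For $(H,\alpha)\in{}_{\mathcal A}\mathfrak M$ put on the algebraic tensor product $\mathcal U\otimes H$ the seminorm $$\Big\|\sum_{j}T_j\otimes x_j\Big\|_{\mathcal F_{\mathcal U}(H)}=\sup\Big\{\Big\|\sum_{j}\alpha(ST_j)x_j\Big\|_{H^n}: n\in\mathbb N,\ S\in M_{n,1}(\mathcal V),\ \|S\|\le 1\Big\},$$ where $\alpha(ST)=(\alpha(S_1T),\dots,\alpha(S_nT))^t$ for $S=(S_1,\dots,S_n)^t$. Let $\mathcal F_{\mathcal U}(H)$ be the associated Hausdorff completion, and write $T\otimes x$ also for the image of $T\otimes x$ in it. Let $B\in\mathcal B$ act on $\mathcal F_{\mathcal U}(H)$ by $\beta(B)(T\otimes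 x)=BT\otimes x$, and for a morphism $F:H_1\to H_2$ of ${}_{\mathcal A}\mathfrak M$ let $\mathcal F_{\mathcal U}(F)(T\otimes x)=T\otimes F(x)$. Then: 1. Each $\mathcal F_{\mathcal U}(H)$ is a Hilbert space and $\beta$ is a normal representation of $\mathcal B$ on it, so that $\mathcal F_{\mathcal U}$ is a functor ${}_{\mathcal A}\mathfrak M\to{}_{\mathcal B}\mathfrak M$. 2. $\mathcal F_{\mathcal U}$ has a $\Delta$-extension: there is a functor $\mathcal G:{}_{\mathcal A}\mathfrak{DM}\to{}_{\mathcal B}\mathfrak{DM}$ whose composition with the inclusion ${}_{\mathcal A}\mathfrak M\hookrightarrow{}_{\mathcal A}\mathfrak{DM}$ equals the composition of $\mathcal F_{\mathcal U}$ with the inclusion ${}_{\mathcal B}\mathfrak M\hookrightarrow{}_{\mathcal B}\mathfrak{DM}$, and it can be chosen so that $\mathcal G(F)(M\otimes x)=M\otimes F(x)$ for all $M\in\mathcal M$, all $x\in H_1$ and all morphisms $F:H_1\to H_2$ of ${}_{\mathcal A}\mathfrak{DM}$. 3. This $\Delta$-extension $\mathcal G$ is a $*$-functor: $\mathcal G(F^*)=\mathcal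 G(F)^*$ for every morphism $F$ of ${}_{\mathcal A}\mathfrak{DM}$. -/

import Mathlib

open scoped TensorProduct InnerProductSpace Topology

universe u

set_option linter.unusedSectionVars false

noncomputable section

namespace DualOpAlg

/-! ### The weak* (σ-weak) topology of `B(E, F)` -/

section WeakStar

variable {E F G : Type*}
  [NormedAddCommGroup E] [InnerProductSpace ℂ E]
  [NormedAddCommGroup F] [InnerProductSpace ℂ F]
  [NormedAddCommGroup G] [InnerProductSpace ℂ G]

/-- Pairs of square summable sequences `(xₙ)` in `E` and `(yₙ)` in `F`. They index the
w*-continuous functionals `T ↦ ∑ ⟨yₙ, T xₙ⟩` of `B(E, F)`. -/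
def SqSummablePair (E F : Type*) [NormedAddCommGroup E] [NormedAddCommGroup F] : Type _ :=
  {p : (ℕ → E) × (ℕ → F) //
    Summable (fun n => ‖p.1 n‖ ^ 2) ∧ Summable (fun n => ‖p.2 n‖ ^ 2)}

theorem SqSummablePair.summable (p : SqSummablePair E F) (T : E →L[ℂ] F) :
    Summable (fun n => ⟪p.1.2 n, T (p.1.1 n)⟫_ℂ) := by
  refine Summable.of_norm_bounded (g := fun n => ‖T‖ * (‖p.1.1 n‖ ^ 2 + ‖p.1.2 n‖ ^ 2))
    ((p.2.1.add p.2.2).mul_left _) (fun n => ?_)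
  have h1 : ‖⟪p.1.2 n, T (p.1.1 n)⟫_ℂ‖ ≤ ‖p.1.2 n‖ * (‖T‖ * ‖p.1.1 n‖) :=
    (norm_inner_le_norm _ _).trans
      (mul_le_mul_of_nonneg_left (T.le_opNorm _) (norm_nonneg _))
  have h2 : ‖p.1.2 n‖ * ‖p.1.1 n‖ ≤ ‖p.1.1 n‖ ^ 2 + ‖p.1.2 n‖ ^ 2 := by
    nlinarith [sq_nonneg (‖p.1.1 n‖ - ‖p.1.2 n‖), sq_nonneg ‖p.1.1 n‖, sq_nonneg ‖p.1.2 n‖]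
  calc _ ≤ _ := h1
    _ = ‖T‖ * (‖p.1.2 n‖ * ‖p.1.1 n‖) := by ring
    _ ≤ _ := mul_le_mul_of_nonneg_left h2 (norm_nonneg _)

/-- The family of all functionals `T ↦ ∑ ⟨yₙ, T xₙ⟩`. -/
def wstarEval (E F : Type*) [NormedAddCommGroup E] [InnerProductSpace ℂ E]
    [NormedAddCommGroup F] [InnerProductSpace ℂ F] :
    (E →L[ℂ] F) →ₗ[ℂ] (SqSummablePair E F → ℂ) where
  toFun T p := ∑' n, ⟪p.1.2 n, T (p.1.1 n)⟫_ℂ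
  map_add' S T := by
    funext p
    simp only [add_apply, inner_add_right, Pi.add_apply]
    exact (p.summable S).tsum_add (p.summable T)
  map_smul' c T := by
    funext p
    simp only [smul_apply, inner_smul_right, Pi.smul_apply, smul_eq_mul,
      RingHom.id_apply]
    exact tsum_mul_left

/-- The weak* topology of `B(E, F)`: the coarsest topology that makes all functionals
`T ↦ ∑ ⟨yₙ, T xₙ⟩` with `(xₙ)`, `(yₙ)` square summable continuous. -/
abbrev wstarTopology (E F : Type*) [NormedAddCommGroup E] [InnerProductSpace ℂ E]
    [NormedAddCommGroup F] [InnerProductSpace ℂ F] : TopologicalSpace (E →L[ℂ] F) :=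
  TopologicalSpace.induced (wstarEval E F) inferInstance

/-- `[s]^{-w*}`: the w*-closure of the linear span of `s`. -/
def wstarSpan (s : Set (E →L[ℂ] F)) : Submodule ℂ (E →L[ℂ] F) :=
  letI : TopologicalSpace (E →L[ℂ] F) := wstarTopology E F
  haveI : ContinuousAdd (E →L[ℂ] F) := continuousAdd_induced (wstarEval E F)
  haveI : ContinuousSMul ℂ (E →L[ℂ] F) := continuousSMul_induced (wstarEval E F)
  (Submodule.span ℂ s).topologicalClosure

theorem subset_wstarSpan (s : Set (E →L[ℂ] F)) : s ⊆ wstarSpan s := fun _ hx =>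
  @subset_closure _ (wstarTopology E F) _ _ (Submodule.subset_span hx)

theorem isClosed_wstarSpan (s : Set (E →L[ℂ] F)) :
    IsClosed[wstarTopology E F] (wstarSpan s : Set (E →L[ℂ] F)) :=
  @isClosed_closure _ (wstarTopology E F) _

/-- A w*-continuous linear map which sends `s` into a w*-closed subspace `p` sends all of
`[s]^{-w*}` into `p`. -/
theorem map_mem_of_mem_wstarSpan {E' F' : Type*}
    [NormedAddCommGroup E'] [InnerProductSpace ℂ E']
    [NormedAddCommGroup F'] [InnerProductSpace ℂ F'] {s : Set (E →L[ℂ] F)}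
    {p : Submodule ℂ (E' →L[ℂ] F')} (hp : IsClosed[wstarTopology E' F'] (p : Set (E' →L[ℂ] F')))
    (f : (E →L[ℂ] F) →ₗ[ℂ] (E' →L[ℂ] F'))
    (hf : Continuous[wstarTopology E F, wstarTopology E' F'] f)
    (hs : ∀ x ∈ s, f x ∈ p) {x : E →L[ℂ] F} (hx : x ∈ wstarSpan s) : f x ∈ p := by
  let : TopologicalSpace (E →L[ℂ] F) := wstarTopology E F
  let : TopologicalSpace (E' →L[ℂ] F') := wstarTopology E' F'
  have h1 : IsClosed (f ⁻¹' (p : Set (E' →L[ℂ] F'))) := hp.preimage hf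
  have h2 : ((Submodule.span ℂ s : Submodule ℂ (E →L[ℂ] F)) : Set (E →L[ℂ] F)) ⊆
      f ⁻¹' (p : Set (E' →L[ℂ] F')) := by
    have : Submodule.span ℂ s ≤ p.comap f := Submodule.span_le.2 hs
    exact this
  exact closure_minimal h2 h1 hx

theorem summable_sq_map (T : E →L[ℂ] F) {x : ℕ → E} (hx : Summable (fun n => ‖x n‖ ^ 2)) :
    Summable (fun n => ‖T (x n)‖ ^ 2) := by
  refine Summable.of_nonneg_of_le (fun n => sq_nonneg _) (fun n => ?_) (hx.mul_left (‖T‖ ^ 2))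
  rw [← mul_pow]
  exact pow_le_pow_left₀ (norm_nonneg _) (T.le_opNorm _) 2

/-- `T ↦ T R` is w*-continuous. -/
theorem wstar_continuous_comp_right (R : E →L[ℂ] F) :
    Continuous[wstarTopology F G, wstarTopology E G]
      (fun T : F →L[ℂ] G => T ∘L R) := by
  let : TopologicalSpace (F →L[ℂ] G) := wstarTopology F G
  refine continuous_induced_rng.2 (continuous_pi fun p => ?_)
  let q : SqSummablePair F G := ⟨(fun n => R (p.1.1 n), p.1.2), summable_sq_map R p.2.1, p.2.2⟩
  exact (continuous_apply q).comp (continuous_induced_dom (f := wstarEval F G))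

/-- `T ↦ R T` is w*-continuous. -/
theorem wstar_continuous_comp_left [CompleteSpace F] [CompleteSpace G] (R : F →L[ℂ] G) :
    Continuous[wstarTopology E F, wstarTopology E G]
      (fun T : E →L[ℂ] F => R ∘L T) := by
  let : TopologicalSpace (E →L[ℂ] F) := wstarTopology E F
  refine continuous_induced_rng.2 (continuous_pi fun p => ?_)
  let q : SqSummablePair E F := ⟨(p.1.1, fun n => R.adjoint (p.1.2 n)), p.2.1,
    summable_sq_map R.adjoint p.2.2⟩
  have h := (continuous_apply q).comp (continuous_induced_dom (f := wstarEval E F))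
  refine h.congr fun T => ?_
  change ∑' n, ⟪R.adjoint (p.1.2 n), T (p.1.1 n)⟫_ℂ = ∑' n, ⟪p.1.2 n, R (T (p.1.1 n))⟫_ℂ
  simp only [ContinuousLinearMap.adjoint_inner_left]

end WeakStar

/-! ### Matrices of operators and completely contractive maps -/

section Matrices

variable {E F : Type*} [NormedAddCommGroup E] [NormedSpace ℂ E]
  [NormedAddCommGroup F] [NormedSpace ℂ F]

/-- The operator `E^n → F^m` (`ℓ²`-sums) given by an `m × n` matrix of operators. -/
def opMatrix {m n : ℕ} (X : Matrix (Fin m) (Fin n) (E →L[ℂ] F)) :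
    PiLp 2 (fun _ : Fin n => E) →L[ℂ] PiLp 2 (fun _ : Fin m => F) :=
  ((PiLp.continuousLinearEquiv 2 ℂ (fun _ : Fin m => F)).symm :
      (Fin m → F) →L[ℂ] PiLp 2 (fun _ : Fin m => F)) ∘L
    ContinuousLinearMap.pi (fun i => ∑ j, X i j ∘L PiLp.proj 2 (fun _ : Fin n => E) j)

theorem opMatrix_apply {m n : ℕ} (X : Matrix (Fin m) (Fin n) (E →L[ℂ] F))
    (v : PiLp 2 (fun _ : Fin n => E)) (i : Fin m) :
    opMatrix X v i = ∑ j, X i j (v j) := by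
  simp [opMatrix]

/-- The column operator `(S₁, …, Sₙ)ᵗ : E → F^n`, an element of `M_{n,1}(B(E, F))`. -/
def colOp {n : ℕ} (S : Fin n → E →L[ℂ] F) :
    PiLp 2 (fun _ : Fin 1 => E) →L[ℂ] PiLp 2 (fun _ : Fin n => F) :=
  opMatrix (Matrix.of fun i (_ : Fin 1) => S i)

/-- Complete contractivity of a representation of an algebra of operators. -/
def IsCompletelyContractive {E₀ : Type*} [NormedAddCommGroup E₀] [NormedSpace ℂ E₀]
    {A : Subalgebra ℂ (E₀ →L[ℂ] E₀)} (φ : A →ₐ[ℂ] (E →L[ℂ] E)) : Prop :=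
  ∀ (n : ℕ) (X : Matrix (Fin n) (Fin n) A),
    ‖opMatrix (X.map (fun a => φ a))‖ ≤ ‖opMatrix (X.map (fun a => (a : E₀ →L[ℂ] E₀)))‖

end Matrices

/-- w*-continuity of a representation; the algebra carries the relative w*-topology. -/
def IsWStarContinuous {E₀ E : Type*} [NormedAddCommGroup E₀] [InnerProductSpace ℂ E₀]
    [NormedAddCommGroup E] [InnerProductSpace ℂ E]
    {A : Subalgebra ℂ (E₀ →L[ℂ] E₀)} (φ : A →ₐ[ℂ] (E →L[ℂ] E)) : Prop :=
  Continuous[TopologicalSpace.induced Subtype.val (wstarTopology E₀ E₀), wstarTopology E E] φ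

/-! ### The categories of normal representations -/

section Categories

variable {H₀ : Type u} [NormedAddCommGroup H₀] [InnerProductSpace ℂ H₀] [CompleteSpace H₀]

/-- The diagonal `Δ(A) = A ∩ A*`. -/
def diagonal (A : Subalgebra ℂ (H₀ →L[ℂ] H₀)) : Set (H₀ →L[ℂ] H₀) :=
  {a | a ∈ A ∧ star a ∈ A}

/-- Normal representations of `A`: Hilbert spaces with a unital completely contractive
w*-continuous homomorphism into the bounded operators. -/
structure NormalRep (A : Subalgebra ℂ (H₀ →L[ℂ] H₀)) where
  carrier : Type u
  [normedAddCommGroup : NormedAddCommGroup carrier]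
  [innerProductSpace : InnerProductSpace ℂ carrier]
  [completeSpace : CompleteSpace carrier]
  rep : A →ₐ[ℂ] (carrier →L[ℂ] carrier)
  completelyContractive : IsCompletelyContractive rep
  wstarContinuous : IsWStarContinuous rep

attribute [instance] NormalRep.normedAddCommGroup NormalRep.innerProductSpace
  NormalRep.completeSpace

variable {A : Subalgebra ℂ (H₀ →L[ℂ] H₀)}

namespace NormalRep

/-- `Hom_A(X, Y)`: bounded operators intertwining the actions of `A`. -/
@[ext]
structure Hom (X Y : NormalRep A) where
  toCLM : X.carrier →L[ℂ] Y.carrier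
  comm : ∀ a : A, toCLM ∘L X.rep a = Y.rep a ∘L toCLM

/-- `Hom^D_A(X, Y)`: bounded operators intertwining the actions of `Δ(A)`. -/
@[ext]
structure DHom (X Y : NormalRep A) where
  toCLM : X.carrier →L[ℂ] Y.carrier
  comm : ∀ a : A, (a : H₀ →L[ℂ] H₀) ∈ diagonal A → toCLM ∘L X.rep a = Y.rep a ∘L toCLM

/-- The category `_A M` of normal representations and `A`-module maps. -/
instance : CategoryTheory.Category (NormalRep A) where
  Hom := Hom
  id X := ⟨ContinuousLinearMap.id ℂ _, fun _ => rfl⟩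
  comp f g := ⟨g.toCLM ∘L f.toCLM, fun a => by
    rw [ContinuousLinearMap.comp_assoc, f.comm, ← ContinuousLinearMap.comp_assoc, g.comm,
      ContinuousLinearMap.comp_assoc]⟩

/-- A completely contractive map is contractive. -/
theorem norm_rep_le (X : NormalRep A) (a : A) : ‖X.rep a‖ ≤ ‖(a : H₀ →L[ℂ] H₀)‖ := by
  have h := X.completelyContractive 1 (Matrix.of fun _ _ => a)
  have h1 : ‖opMatrix (Matrix.map (Matrix.of fun _ _ => a : Matrix (Fin 1) (Fin 1) A)
      (fun a => (a : H₀ →L[ℂ] H₀)))‖ ≤ ‖(a : H₀ →L[ℂ] H₀)‖ := by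
    refine ContinuousLinearMap.opNorm_le_bound _ (norm_nonneg _) fun v => ?_
    have e1 : ‖v‖ = ‖v 0‖ := by simp [PiLp.norm_eq_of_L2]
    rw [e1, PiLp.norm_eq_of_L2]
    simpa [opMatrix_apply] using ContinuousLinearMap.le_opNorm (a : H₀ →L[ℂ] H₀) (v 0)
  refine ContinuousLinearMap.opNorm_le_bound _ (norm_nonneg _) fun x => ?_
  have h2 := ((opMatrix (Matrix.map (Matrix.of fun _ _ => a : Matrix (Fin 1) (Fin 1) A)
      (fun a => X.rep a))).le_of_opNorm_le (h.trans h1)) (WithLp.toLp 2 fun _ => x)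
  simpa [PiLp.norm_eq_of_L2, opMatrix_apply] using h2

/-- A normal representation is a `*`-map on the diagonal; selfadjoint case. -/
theorem rep_isSelfAdjoint (X : NormalRep A) (a : A)
    (ha : IsSelfAdjoint (a : H₀ →L[ℂ] H₀)) : IsSelfAdjoint (X.rep a) := by
  have key : ∀ (t : ℝ) (x : X.carrier),
      -2 * t * (⟪x, X.rep a x⟫_ℂ).im ≤ t ^ 2 * (‖(a : H₀ →L[ℂ] H₀)‖ ^ 2 * ‖x‖ ^ 2) := by
    intro t x
    have h1 : ‖((1 + ((t : ℂ) * Complex.I) • a : A) : H₀ →L[ℂ] H₀)‖ ^ 2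
        ≤ 1 + t ^ 2 * ‖(a : H₀ →L[ℂ] H₀)‖ ^ 2 := by
      rw [sq, ← CStarRing.norm_star_mul_self]
      have e : star ((1 + ((t : ℂ) * Complex.I) • a : A) : H₀ →L[ℂ] H₀) *
          ((1 + ((t : ℂ) * Complex.I) • a : A) : H₀ →L[ℂ] H₀)
          = 1 + ((t : ℂ) ^ 2) • ((a : H₀ →L[ℂ] H₀) * a) := by
        push_cast
        simp only [star_add, star_one, star_smul, ha.star_eq, mul_add, add_mul, one_mul, mul_one,
          smul_mul_smul_comm]
        have : star ((t : ℂ) * Complex.I) = -((t : ℂ) * Complex.I) := by simp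
        rw [this]
        have : -((t : ℂ) * Complex.I) * ((t : ℂ) * Complex.I) = (t : ℂ) ^ 2 := by
          linear_combination (-(t : ℂ) ^ 2) * Complex.I_sq
        rw [this, neg_smul]
        abel
      rw [e]
      refine (norm_add_le _ _).trans ?_
      refine add_le_add ContinuousLinearMap.norm_id_le ?_
      rw [norm_smul]
      have : ‖(t : ℂ) ^ 2‖ = t ^ 2 := by simp
      rw [this, sq ‖_‖]
      exact mul_le_mul_of_nonneg_left (norm_mul_le _ _) (sq_nonneg _)
    have h2 : ‖x + ((t : ℂ) * Complex.I) • X.rep a x‖ ^ 2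
        ≤ (1 + t ^ 2 * ‖(a : H₀ →L[ℂ] H₀)‖ ^ 2) * ‖x‖ ^ 2 := by
      have h3 := (X.rep (1 + ((t : ℂ) * Complex.I) • a)).le_of_opNorm_le (X.norm_rep_le _) x
      have h4 : X.rep (1 + ((t : ℂ) * Complex.I) • a) x
          = x + ((t : ℂ) * Complex.I) • X.rep a x := by
        simp
      rw [h4] at h3
      calc _ ≤ _ := pow_le_pow_left₀ (norm_nonneg _) h3 2
        _ = _ := mul_pow _ _ _
        _ ≤ _ := mul_le_mul_of_nonneg_right h1 (sq_nonneg _)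
    rw [@norm_add_sq ℂ] at h2
    have h5 : RCLike.re ⟪x, ((t : ℂ) * Complex.I) • X.rep a x⟫_ℂ
        = - t * (⟪x, X.rep a x⟫_ℂ).im := by
      rw [inner_smul_right]
      simp
    rw [h5] at h2
    nlinarith [sq_nonneg ‖((t : ℂ) * Complex.I) • X.rep a x‖]
  rw [ContinuousLinearMap.isSelfAdjoint_iff_isSymmetric,
    LinearMap.isSymmetric_iff_inner_map_self_real]
  intro x
  have him : (⟪x, X.rep a x⟫_ℂ).im = 0 := by
    set c := (⟪x, X.rep a x⟫_ℂ).im with hc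
    set D := ‖(a : H₀ →L[ℂ] H₀)‖ ^ 2 * ‖x‖ ^ 2 with hD
    have hD0 : 0 ≤ D := by positivity
    have h := key (-c / (D + 1)) x
    rw [← hc, ← hD] at h
    have hpos : 0 < D + 1 := by linarith
    field_simp at h
    have : c ^ 2 ≤ 0 := by nlinarith [sq_nonneg c]
    exact pow_eq_zero_iff (two_ne_zero) |>.1 (le_antisymm this (sq_nonneg c))
  have h6 : (starRingEnd ℂ) ⟪x, X.rep a x⟫_ℂ = ⟪x, X.rep a x⟫_ℂ := Complex.conj_eq_iff_im.2 him
  rw [inner_conj_symm] at h6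
  change (starRingEnd ℂ) ⟪X.rep a x, x⟫_ℂ = ⟪X.rep a x, x⟫_ℂ
  rw [inner_conj_symm, h6]

/-- A normal representation restricts to a `*`-homomorphism on the diagonal. -/
theorem rep_star (X : NormalRep A) (a : A) (ha : star (a : H₀ →L[ℂ] H₀) ∈ A) :
    X.rep ⟨star (a : H₀ →L[ℂ] H₀), ha⟩ = star (X.rep a) := by
  set b : A := ⟨star (a : H₀ →L[ℂ] H₀), ha⟩ with hb
  have h1 := X.rep_isSelfAdjoint (a + b) (by
    simp [hb])
  have h2 := X.rep_isSelfAdjoint (Complex.I • (a - b)) (by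
    rw [isSelfAdjoint_iff]
    simp only [hb, SetLike.val_smul, AddSubgroupClass.coe_sub, star_smul, star_sub, star_star]
    simp [sub_eq_add_neg, add_comm])
  have e1 := h1.star_eq
  have e2 := h2.star_eq
  simp only [map_add, map_sub, map_smul, star_add, star_sub, star_smul] at e1 e2
  have e3 : star (X.rep a) - star (X.rep b) = -(X.rep a - X.rep b) := by
    have h3 := congrArg (fun z => Complex.I • z) e2
    have h4 : star Complex.I = -Complex.I := by simp
    simpa only [h4, neg_smul, smul_neg, smul_smul, Complex.I_mul_I, neg_neg, one_smul] using h3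
  have e4 : (2 : ℂ) • X.rep b = (2 : ℂ) • star (X.rep a) := by
    rw [two_smul, two_smul]
    have := congrArg₂ (· + ·) e1 e3
    rw [show star (X.rep a) + star (X.rep b) + (star (X.rep a) - star (X.rep b))
      = star (X.rep a) + star (X.rep a) by abel] at this
    rw [this]
    abel
  exact smul_right_injective _ (two_ne_zero) e4

/-- The adjoint of a `Δ(A)`-module map is a `Δ(A)`-module map. -/
def DHom.adjoint {X Y : NormalRep A} (f : DHom X Y) : DHom Y X where
  toCLM := ContinuousLinearMap.adjoint f.toCLM
  comm a ha := by
    have h := f.comm ⟨star (a : H₀ →L[ℂ] H₀), ha.2⟩ ⟨ha.2, by simp⟩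
    rw [X.rep_star a ha.2, Y.rep_star a ha.2] at h
    have h' := congrArg ContinuousLinearMap.adjoint h
    simp only [ContinuousLinearMap.adjoint_comp, ContinuousLinearMap.star_eq_adjoint,
      ContinuousLinearMap.adjoint_adjoint] at h'
    exact h'.symm

end NormalRep

/-- The objects of the category `_A DM`: they are the objects of `_A M`. -/
structure DNormalRep (A : Subalgebra ℂ (H₀ →L[ℂ] H₀)) where
  obj : NormalRep A

/-- The category `_A DM` of normal representations of `A` and `Δ(A)`-module maps. -/
instance : CategoryTheory.Category (DNormalRep A) where
  Hom X Y := NormalRep.DHom X.obj Y.obj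
  id X := ⟨ContinuousLinearMap.id ℂ _, fun _ _ => rfl⟩
  comp f g := ⟨g.toCLM ∘L f.toCLM, fun a ha => by
    rw [ContinuousLinearMap.comp_assoc, f.comm a ha, ← ContinuousLinearMap.comp_assoc,
      g.comm a ha, ContinuousLinearMap.comp_assoc]⟩

/-- The inclusion functor `_A M ↪ _A DM`. -/
def inclusion (A : Subalgebra ℂ (H₀ →L[ℂ] H₀)) :
    CategoryTheory.Functor (NormalRep A) (DNormalRep A) where
  obj X := ⟨X⟩
  map f := ⟨NormalRep.Hom.toCLM f, fun a _ => NormalRep.Hom.comm f a⟩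

variable {K₀ : Type u} [NormedAddCommGroup K₀] [InnerProductSpace ℂ K₀] [CompleteSpace K₀]
  {B : Subalgebra ℂ (K₀ →L[ℂ] K₀)}

/-- `G` is a Δ-extension of `F`: the square formed by `F`, `G` and the inclusions commutes. -/
def IsDeltaExtension (F : CategoryTheory.Functor (NormalRep A) (NormalRep B))
    (G : CategoryTheory.Functor (DNormalRep A) (DNormalRep B)) : Prop :=
  (inclusion A).comp G = F.comp (inclusion B)

theorem IsDeltaExtension.obj_eq {F : CategoryTheory.Functor (NormalRep A) (NormalRep B)}
    {G : CategoryTheory.Functor (DNormalRep A) (DNormalRep B)} (h : IsDeltaExtension F G)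
    (X : DNormalRep A) : G.obj X = ⟨F.obj X.obj⟩ :=
  CategoryTheory.Functor.congr_obj h X.obj

/-- If `G` is a Δ-extension of `F`, then `G(X) = F(X)` for all objects `X`; this is the operator
`G(f)`, regarded as an operator `F(X) → F(Y)` along these equalities. -/
def IsDeltaExtension.mapCLM {F : CategoryTheory.Functor (NormalRep A) (NormalRep B)}
    {G : CategoryTheory.Functor (DNormalRep A) (DNormalRep B)} (h : IsDeltaExtension F G)
    {X Y : DNormalRep A} (f : X ⟶ Y) : (F.obj X.obj).carrier →L[ℂ] (F.obj Y.obj).carrier :=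
  NormalRep.DHom.toCLM (CategoryTheory.CategoryStruct.comp
    (CategoryTheory.eqToHom (h.obj_eq X).symm)
    (CategoryTheory.CategoryStruct.comp (G.map f) (CategoryTheory.eqToHom (h.obj_eq Y))))

/-- `G` is a `*`-functor: `G(f*) = G(f)*` for all `Δ(A)`-module maps `f`. -/
def IsStarFunctor (G : CategoryTheory.Functor (DNormalRep A) (DNormalRep B)) : Prop :=
  ∀ (X Y : DNormalRep A) (f : X ⟶ Y),
    G.map (show Y ⟶ X from NormalRep.DHom.adjoint f) = NormalRep.DHom.adjoint (G.map f)

end Categories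

/-! ### TRO equivalence and the bimodules `U`, `V` -/

section TRO

variable {H₀ K₀ : Type u}
  [NormedAddCommGroup H₀] [InnerProductSpace ℂ H₀] [CompleteSpace H₀]
  [NormedAddCommGroup K₀] [InnerProductSpace ℂ K₀] [CompleteSpace K₀]

/-- A ternary ring of operators: a subspace `M` of `B(H₀, K₀)` with `M M* M ⊆ M`. -/
def IsTRO (M : Submodule ℂ (H₀ →L[ℂ] K₀)) : Prop :=
  ∀ a ∈ M, ∀ b ∈ M, ∀ c ∈ M, a ∘L ContinuousLinearMap.adjoint b ∘L c ∈ M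

/-- The TRO `M` implements a TRO equivalence of `A` and `B`:
`A = [M* B M]^{-w*}` and `B = [M A M*]^{-w*}`. In particular `A` and `B` are w*-closed. -/
structure IsTROEquivalence (A : Subalgebra ℂ (H₀ →L[ℂ] H₀)) (B : Subalgebra ℂ (K₀ →L[ℂ] K₀))
    (M : Submodule ℂ (H₀ →L[ℂ] K₀)) : Prop where
  isTRO : IsTRO M
  left_eq : Subalgebra.toSubmodule A =
    wstarSpan {T | ∃ m ∈ M, ∃ b ∈ B, ∃ n ∈ M, T = ContinuousLinearMap.adjoint m ∘L b ∘L n}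
  right_eq : Subalgebra.toSubmodule B =
    wstarSpan {T | ∃ m ∈ M, ∃ a ∈ A, ∃ n ∈ M, T = m ∘L a ∘L ContinuousLinearMap.adjoint n}

/-- `U = [B M]^{-w*} ⊆ B(H₀, K₀)`. -/
def bimodU (B : Subalgebra ℂ (K₀ →L[ℂ] K₀)) (M : Submodule ℂ (H₀ →L[ℂ] K₀)) :
    Submodule ℂ (H₀ →L[ℂ] K₀) :=
  wstarSpan {T | ∃ b ∈ B, ∃ m ∈ M, T = b ∘L m}

/-- `V = [M* B]^{-w*} ⊆ B(K₀, H₀)`. -/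
def bimodV (B : Subalgebra ℂ (K₀ →L[ℂ] K₀)) (M : Submodule ℂ (H₀ →L[ℂ] K₀)) :
    Submodule ℂ (K₀ →L[ℂ] H₀) :=
  wstarSpan {T | ∃ m ∈ M, ∃ b ∈ B, T = ContinuousLinearMap.adjoint m ∘L b}

variable {A : Subalgebra ℂ (H₀ →L[ℂ] H₀)} {B : Subalgebra ℂ (K₀ →L[ℂ] K₀)}
  {M : Submodule ℂ (H₀ →L[ℂ] K₀)}

/-- Composition on the left, as a linear map. -/
def compLeft {E F G : Type*} [NormedAddCommGroup E] [NormedSpace ℂ E]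
    [NormedAddCommGroup F] [NormedSpace ℂ F] [NormedAddCommGroup G] [NormedSpace ℂ G]
    (R : F →L[ℂ] G) : (E →L[ℂ] F) →ₗ[ℂ] (E →L[ℂ] G) where
  toFun T := R ∘L T
  map_add' S T := by ext; simp
  map_smul' c T := by ext; simp

/-- Composition on the right, as a linear map. -/
def compRight {E F G : Type*} [NormedAddCommGroup E] [NormedSpace ℂ E]
    [NormedAddCommGroup F] [NormedSpace ℂ F] [NormedAddCommGroup G] [NormedSpace ℂ G]
    (R : E →L[ℂ] F) : (F →L[ℂ] G) →ₗ[ℂ] (E →L[ℂ] G) where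
  toFun T := T ∘L R
  map_add' S T := by ext; simp
  map_smul' c T := by ext; simp

/-- `M ⊆ U`. -/
theorem mem_bimodU {m : H₀ →L[ℂ] K₀} (hm : m ∈ M) : m ∈ bimodU B M :=
  subset_wstarSpan _ ⟨1, B.one_mem, m, hm, rfl⟩

/-- `B U ⊆ U`. -/
theorem comp_mem_bimodU {b : K₀ →L[ℂ] K₀} (hb : b ∈ B) {T : H₀ →L[ℂ] K₀}
    (hT : T ∈ bimodU B M) : b ∘L T ∈ bimodU B M := by
  refine map_mem_of_mem_wstarSpan (isClosed_wstarSpan _) (compLeft b)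
    (wstar_continuous_comp_left b) ?_ hT
  rintro _ ⟨c, hc, m, hm, rfl⟩
  exact subset_wstarSpan _ ⟨b * c, B.mul_mem hb hc, m, hm, rfl⟩

/-- `V B ⊆ V`. -/
theorem comp_mem_bimodV {b : K₀ →L[ℂ] K₀} (hb : b ∈ B) {T : K₀ →L[ℂ] H₀}
    (hT : T ∈ bimodV B M) : T ∘L b ∈ bimodV B M := by
  refine map_mem_of_mem_wstarSpan (isClosed_wstarSpan _) (compRight b)
    (wstar_continuous_comp_right b) ?_ hT
  rintro _ ⟨m, hm, c, hc, rfl⟩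
  exact subset_wstarSpan _ ⟨m, hm, c * b, B.mul_mem hc hb, rfl⟩

/-- `V U ⊆ A`. -/
theorem IsTROEquivalence.comp_mem (h : IsTROEquivalence A B M) {S : K₀ →L[ℂ] H₀}
    (hS : S ∈ bimodV B M) {T : H₀ →L[ℂ] K₀} (hT : T ∈ bimodU B M) : S ∘L T ∈ A := by
  have hA : IsClosed[wstarTopology H₀ H₀]
      ((Subalgebra.toSubmodule A : Submodule ℂ (H₀ →L[ℂ] H₀)) : Set (H₀ →L[ℂ] H₀)) := by
    rw [h.left_eq]
    exact isClosed_wstarSpan _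
  have h1 : ∀ m ∈ M, ∀ b ∈ B, ∀ T ∈ bimodU B M,
      (ContinuousLinearMap.adjoint m ∘L b) ∘L T ∈ Subalgebra.toSubmodule A := by
    intro m hm b hb T hT
    refine map_mem_of_mem_wstarSpan hA (compLeft (ContinuousLinearMap.adjoint m ∘L b))
      (wstar_continuous_comp_left _) ?_ hT
    rintro _ ⟨c, hc, n, hn, rfl⟩
    rw [h.left_eq]
    exact subset_wstarSpan _ ⟨m, hm, b * c, B.mul_mem hb hc, n, hn, rfl⟩
  have h2 : S ∘L T ∈ Subalgebra.toSubmodule A := by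
    refine map_mem_of_mem_wstarSpan hA (compRight T) (wstar_continuous_comp_right T) ?_ hS
    rintro _ ⟨m, hm, b, hb, rfl⟩
    exact h1 m hm b hb T hT
  exact h2

/-! ### The seminorm on `U ⊗ H` and its completion -/

/-- The map `T ⊗ x ↦ α(S T) x = (α(S₁ T) x, …, α(Sₙ T) x)` from `U ⊗ H` to `H^n`, for a column
`S` with entries in `V`. -/
def colEval (h : IsTROEquivalence A B M) (X : NormalRep A) {n : ℕ} (S : Fin n → bimodV B M) :
    (bimodU B M) ⊗[ℂ] X.carrier →ₗ[ℂ] PiLp 2 (fun _ : Fin n => X.carrier) :=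
  TensorProduct.lift (LinearMap.mk₂ ℂ
    (fun (T : bimodU B M) (x : X.carrier) => WithLp.toLp 2 fun i =>
      X.rep ⟨(S i : K₀ →L[ℂ] H₀) ∘L (T : H₀ →L[ℂ] K₀), h.comp_mem (S i).2 T.2⟩ x)
    (fun T T' x => by
      ext i
      have : (⟨(S i : K₀ →L[ℂ] H₀) ∘L ((T + T' : bimodU B M) : H₀ →L[ℂ] K₀),
          h.comp_mem (S i).2 (T + T').2⟩ : A) =
          ⟨_, h.comp_mem (S i).2 T.2⟩ + ⟨_, h.comp_mem (S i).2 T'.2⟩ := by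
        ext; simp
      simp only [this, map_add, add_apply, PiLp.add_apply])
    (fun c T x => by
      ext i
      have : (⟨(S i : K₀ →L[ℂ] H₀) ∘L ((c • T : bimodU B M) : H₀ →L[ℂ] K₀),
          h.comp_mem (S i).2 (c • T).2⟩ : A) = c • ⟨_, h.comp_mem (S i).2 T.2⟩ := by
        ext; simp
      simp only [this, map_smul, smul_apply, PiLp.smul_apply])
    (fun T x y => by ext i; simp)
    (fun c T x => by ext i; simp))

theorem colEval_tmul (h : IsTROEquivalence A B M) (X : NormalRep A) {n : ℕ}
    (S : Fin n → bimodV B M) (T : bimodU B M) (x : X.carrier) (i : Fin n) :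
    colEval h X S (T ⊗ₜ x) i =
      X.rep ⟨(S i : K₀ →L[ℂ] H₀) ∘L (T : H₀ →L[ℂ] K₀), h.comp_mem (S i).2 T.2⟩ x := by
  simp [colEval]

/-- The union over `n` of the unit balls of `M_{n,1}(V)`. -/
def ColBall (B : Subalgebra ℂ (K₀ →L[ℂ] K₀)) (M : Submodule ℂ (H₀ →L[ℂ] K₀)) : Type u :=
  Σ n : ℕ, {S : Fin n → bimodV B M // ‖colOp (fun i => (S i : K₀ →L[ℂ] H₀))‖ ≤ 1}

instance : Nonempty (ColBall B M) :=
  ⟨⟨0, fun i => i.elim0, by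
    refine ContinuousLinearMap.opNorm_le_bound _ zero_le_one fun v => ?_
    have : ‖colOp (fun i : Fin 0 => ((i.elim0 : bimodV B M) : K₀ →L[ℂ] H₀)) v‖ = 0 := by
      simp [PiLp.norm_eq_of_L2]
    rw [this]
    positivity⟩⟩

/-- The supremum over `S` in the unit balls of `M_{n,1}(V)`, `n ∈ ℕ`, of
`‖∑ Tⱼ ⊗ xⱼ‖_S = ‖∑ α(S Tⱼ) xⱼ‖`. -/
def supNorm (h : IsTROEquivalence A B M) (X : NormalRep A)
    (z : (bimodU B M) ⊗[ℂ] X.carrier) : ℝ :=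
  ⨆ S : ColBall B M, ‖colEval h X S.2.1 z‖

theorem norm_colOp_apply {n : ℕ} (S : Fin n → K₀ →L[ℂ] H₀) (y : K₀) :
    ‖(WithLp.toLp 2 fun i => S i y : PiLp 2 fun _ : Fin n => H₀)‖ ≤ ‖colOp S‖ * ‖y‖ := by
  have h1 := (colOp S).le_opNorm (WithLp.toLp 2 fun _ => y)
  have h2 : colOp S (WithLp.toLp 2 fun _ => y) = WithLp.toLp 2 fun i => S i y := by
    ext i
    simp [colOp, opMatrix_apply]
  have h3 : ‖(WithLp.toLp 2 fun _ => y : PiLp 2 fun _ : Fin 1 => K₀)‖ = ‖y‖ := by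
    simp [PiLp.norm_eq_of_L2]
  rwa [h2, h3] at h1

theorem colEval_bound (h : IsTROEquivalence A B M) (X : NormalRep A) (S : ColBall B M)
    (T : bimodU B M) (x : X.carrier) :
    ‖colEval h X S.2.1 (T ⊗ₜ x)‖ ≤ ‖(T : H₀ →L[ℂ] K₀)‖ * ‖x‖ := by
  obtain ⟨n, S, hS⟩ := S
  change ‖colEval h X S (T ⊗ₜ x)‖ ≤ _
  rcases n with _ | n
  · have : ‖colEval h X S (T ⊗ₜ x)‖ = 0 := by simp [PiLp.norm_eq_of_L2]
    rw [this]
    positivity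
  · let Y : Matrix (Fin (n + 1)) (Fin (n + 1)) A := Matrix.of fun i j =>
      if j = 0 then ⟨(S i : K₀ →L[ℂ] H₀) ∘L (T : H₀ →L[ℂ] K₀), h.comp_mem (S i).2 T.2⟩ else 0
    have h1 : ‖opMatrix (Y.map (fun a => (a : H₀ →L[ℂ] H₀)))‖ ≤ ‖(T : H₀ →L[ℂ] K₀)‖ := by
      refine ContinuousLinearMap.opNorm_le_bound _ (norm_nonneg _) fun v => ?_
      have e : opMatrix (Y.map (fun a => (a : H₀ →L[ℂ] H₀))) v
          = WithLp.toLp 2 fun i => (S i : K₀ →L[ℂ] H₀) ((T : H₀ →L[ℂ] K₀) (v 0)) := by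
        ext i
        rw [opMatrix_apply, Finset.sum_eq_single 0]
        · simp [Y]
        · intro j _ hj
          simp [Y, hj]
        · simp
      rw [e]
      calc _ ≤ _ := norm_colOp_apply _ _
        _ ≤ 1 * (‖(T : H₀ →L[ℂ] K₀)‖ * ‖v‖) := by
          refine mul_le_mul hS ?_ (norm_nonneg _) zero_le_one
          exact (ContinuousLinearMap.le_opNorm _ _).trans
            (mul_le_mul_of_nonneg_left (PiLp.norm_apply_le v 0) (norm_nonneg _))
        _ = _ := one_mul _
    have h2 := (opMatrix (Y.map (fun a => X.rep a))).le_of_opNorm_le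
      ((X.completelyContractive _ Y).trans h1) (WithLp.toLp 2 (Pi.single 0 x))
    have e2 : opMatrix (Y.map (fun a => X.rep a)) (WithLp.toLp 2 (Pi.single 0 x))
        = colEval h X S (T ⊗ₜ x) := by
      ext i
      rw [opMatrix_apply, Finset.sum_eq_single 0, colEval_tmul]
      · simp [Y]
      · intro j _ hj
        simp [hj]
      · simp
    rw [e2] at h2
    simpa using h2

theorem supNorm_bddAbove (h : IsTROEquivalence A B M) (X : NormalRep A)
    (z : (bimodU B M) ⊗[ℂ] X.carrier) :
    BddAbove (Set.range fun S : ColBall B M => ‖colEval h X S.2.1 z‖) := by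
  induction z using TensorProduct.induction_on with
  | zero => exact ⟨0, by rintro _ ⟨S, rfl⟩; simp⟩
  | tmul T x => exact ⟨_, by rintro _ ⟨S, rfl⟩; exact colEval_bound h X S T x⟩
  | add z w hz hw =>
    obtain ⟨a, ha⟩ := hz
    obtain ⟨b, hb⟩ := hw
    refine ⟨a + b, ?_⟩
    rintro _ ⟨S, rfl⟩
    simp only [map_add]
    exact (norm_add_le _ _).trans (add_le_add (ha ⟨S, rfl⟩) (hb ⟨S, rfl⟩))

theorem le_supNorm (h : IsTROEquivalence A B M) (X : NormalRep A) (S : ColBall B M)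
    (z : (bimodU B M) ⊗[ℂ] X.carrier) : ‖colEval h X S.2.1 z‖ ≤ supNorm h X z :=
  le_ciSup (supNorm_bddAbove h X z) S

theorem supNorm_nonneg (h : IsTROEquivalence A B M) (X : NormalRep A)
    (z : (bimodU B M) ⊗[ℂ] X.carrier) : 0 ≤ supNorm h X z :=
  Real.iSup_nonneg fun _ => norm_nonneg _

/-- The supremum seminorm `‖·‖_{F_U(H)}` on `U ⊗ H`. -/
def supSeminorm (h : IsTROEquivalence A B M) (X : NormalRep A) :
    Seminorm ℂ ((bimodU B M) ⊗[ℂ] X.carrier) :=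
  Seminorm.of (supNorm h X)
    (fun z w => ciSup_le fun S => by
      rw [map_add]
      exact (norm_add_le _ _).trans (add_le_add (le_supNorm h X S z) (le_supNorm h X S w)))
    (fun c z => by
      simp only [supNorm, map_smul, norm_smul]
      exact (Real.mul_iSup_of_nonneg (norm_nonneg c) _).symm)

/-- The algebraic tensor product `U ⊗ H` with its supremum seminorm. -/
def PreFU (_h : IsTROEquivalence A B M) (X : NormalRep A) : Type u :=
  (bimodU B M) ⊗[ℂ] X.carrier

instance (h : IsTROEquivalence A B M) (X : NormalRep A) : SeminormedAddCommGroup (PreFU h X) :=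
  (supSeminorm h X).toAddGroupSeminorm.toSeminormedAddCommGroup

instance (h : IsTROEquivalence A B M) (X : NormalRep A) : Module ℂ (PreFU h X) :=
  inferInstanceAs (Module ℂ ((bimodU B M) ⊗[ℂ] X.carrier))

instance (h : IsTROEquivalence A B M) (X : NormalRep A) : NormedSpace ℂ (PreFU h X) where
  norm_smul_le c z := (map_smul_eq_mul (supSeminorm h X) c z).le

/-- The space `F_U(H)`: the (Hausdorff) completion of `U ⊗ H` for the supremum seminorm. -/
abbrev FUSpace (h : IsTROEquivalence A B M) (X : NormalRep A) : Type u :=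
  UniformSpace.Completion (PreFU h X)

/-- The image of `T ⊗ x` in `F_U(H)`. -/
def FUSpace.tmul (h : IsTROEquivalence A B M) (X : NormalRep A) (T : bimodU B M)
    (x : X.carrier) : FUSpace h X :=
  ((show PreFU h X from T ⊗ₜ[ℂ] x) : UniformSpace.Completion (PreFU h X))

theorem FUSpace.hom_ext {h : IsTROEquivalence A B M} {X : NormalRep A} {E : Type*}
    [NormedAddCommGroup E] [NormedSpace ℂ E] {f g : FUSpace h X →L[ℂ] E}
    (hfg : ∀ (T : bimodU B M) (x : X.carrier),
      f (FUSpace.tmul h X T x) = g (FUSpace.tmul h X T x)) : f = g := by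
  ext z
  induction z using UniformSpace.Completion.induction_on with
  | hp => exact isClosed_eq f.continuous g.continuous
  | ih z =>
    change (bimodU B M) ⊗[ℂ] X.carrier at z
    let ι : (bimodU B M) ⊗[ℂ] X.carrier →ₗ[ℂ] FUSpace h X :=
      (UniformSpace.Completion.toComplL (𝕜 := ℂ) (E := PreFU h X)).toLinearMap
    have : f.toLinearMap ∘ₗ ι = g.toLinearMap ∘ₗ ι := TensorProduct.ext' hfg
    exact LinearMap.congr_fun this z

theorem colEval_le (h : IsTROEquivalence A B M) (X : NormalRep A) {n : ℕ}
    (S : Fin n → bimodV B M) (z : (bimodU B M) ⊗[ℂ] X.carrier) :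
    ‖colEval h X S z‖ ≤ ‖colOp (fun i => (S i : K₀ →L[ℂ] H₀))‖ * supNorm h X z := by
  have hsm : ∀ c : ℂ, colEval h X (fun i => c • S i) z = c • colEval h X S z := by
    intro c
    have : colEval h X (fun i => c • S i) = c • colEval h X S := by
      refine TensorProduct.ext' fun T x => ?_
      ext i
      have e : (⟨((c • S i : bimodV B M) : K₀ →L[ℂ] H₀) ∘L (T : H₀ →L[ℂ] K₀),
          h.comp_mem (c • S i).2 T.2⟩ : A) = c • ⟨_, h.comp_mem (S i).2 T.2⟩ := by
        ext; simp
      simp only [LinearMap.smul_apply, PiLp.smul_apply, colEval_tmul, e, map_smul, smul_apply]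
    rw [this, LinearMap.smul_apply]
  have hcol : ∀ c : ℂ, colOp (fun i => ((c • S i : bimodV B M) : K₀ →L[ℂ] H₀))
      = c • colOp (fun i => (S i : K₀ →L[ℂ] H₀)) := by
    intro c
    ext v i
    simp [colOp, opMatrix_apply]
  set r := ‖colOp (fun i => (S i : K₀ →L[ℂ] H₀))‖ with hr
  rcases (norm_nonneg (colOp (fun i => (S i : K₀ →L[ℂ] H₀)))).eq_or_lt with h0 | hpos
  · have hle : ∀ k : ℕ, (k : ℝ) * ‖colEval h X S z‖ ≤ supNorm h X z := by
      intro k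
      have := le_supNorm h X ⟨n, fun i => (k : ℂ) • S i, by
        rw [hcol]
        refine (ContinuousLinearMap.opNorm_smul_le _ _).trans ?_
        rw [← h0, mul_zero]
        exact zero_le_one⟩ z
      simpa [hsm, norm_smul] using this
    rw [hr, ← h0, zero_mul]
    by_contra hcon
    push Not at hcon
    obtain ⟨k, hk⟩ := exists_nat_gt (supNorm h X z / ‖colEval h X S z‖)
    rw [div_lt_iff₀ hcon] at hk
    exact absurd (hle k) (not_le.2 hk)
  · have := le_supNorm h X ⟨n, fun i => ((r⁻¹ : ℝ) : ℂ) • S i, by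
      rw [hcol]
      refine (ContinuousLinearMap.opNorm_smul_le _ _).trans ?_
      rw [← hr, Complex.norm_real, Real.norm_of_nonneg (by positivity),
        inv_mul_cancel₀ hpos.ne']⟩ z
    have h1 : r⁻¹ * ‖colEval h X S z‖ ≤ supNorm h X z := by
      have e : ‖colEval h X (fun i => ((r⁻¹ : ℝ) : ℂ) • S i) z‖ = r⁻¹ * ‖colEval h X S z‖ := by
        rw [hsm, norm_smul, Complex.norm_real, Real.norm_of_nonneg (by positivity)]
      exact e ▸ this
    rwa [inv_mul_le_iff₀ hpos] at h1

/-! ### The action of `B` on `F_U(H)` and the functor `F_U` -/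

/-- `T ↦ b T` on `U`. -/
def mulU (b : B) : bimodU B M →ₗ[ℂ] bimodU B M :=
  (compLeft (b : K₀ →L[ℂ] K₀)).restrict fun _ hT => comp_mem_bimodU b.2 hT

/-- `T ⊗ x ↦ b T ⊗ x` on `U ⊗ H`. -/
def preAct (h : IsTROEquivalence A B M) (X : NormalRep A) (b : B) :
    PreFU h X →L[ℂ] PreFU h X :=
  LinearMap.mkContinuous
    (show (bimodU B M) ⊗[ℂ] X.carrier →ₗ[ℂ] (bimodU B M) ⊗[ℂ] X.carrier from
      (mulU b).rTensor X.carrier) ‖(b : K₀ →L[ℂ] K₀)‖ (fun z => by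
    change supNorm h X ((mulU b).rTensor X.carrier z) ≤ ‖(b : K₀ →L[ℂ] K₀)‖ * supNorm h X z
    refine ciSup_le fun S => ?_
    obtain ⟨n, S, hS⟩ := S
    change ‖colEval h X S ((mulU b).rTensor X.carrier z)‖ ≤ _
    let S' : Fin n → bimodV B M := fun i =>
      ⟨(S i : K₀ →L[ℂ] H₀) ∘L (b : K₀ →L[ℂ] K₀), comp_mem_bimodV b.2 (S i).2⟩
    have e : colEval h X S ∘ₗ (mulU b).rTensor X.carrier = colEval h X S' := by
      refine TensorProduct.ext' fun T x => ?_
      ext i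
      simp only [LinearMap.comp_apply, LinearMap.rTensor_tmul, colEval_tmul]
      rfl
    have e' : colEval h X S ((mulU b).rTensor X.carrier z) = colEval h X S' z :=
      LinearMap.congr_fun e z
    rw [e']
    refine (colEval_le h X S' z).trans
      (mul_le_mul_of_nonneg_right ?_ (supNorm_nonneg h X z))
    refine ContinuousLinearMap.opNorm_le_bound _ (norm_nonneg _) fun v => ?_
    have e2 : colOp (fun i => (S' i : K₀ →L[ℂ] H₀)) v
        = WithLp.toLp 2 fun i => (S i : K₀ →L[ℂ] H₀) ((b : K₀ →L[ℂ] K₀) (v 0)) := by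
      ext i
      simp [colOp, opMatrix_apply, S']
    rw [e2]
    calc _ ≤ _ := norm_colOp_apply _ _
      _ ≤ 1 * (‖(b : K₀ →L[ℂ] K₀)‖ * ‖v‖) := by
        refine mul_le_mul hS ?_ (norm_nonneg _) zero_le_one
        exact (ContinuousLinearMap.le_opNorm _ _).trans
          (mul_le_mul_of_nonneg_left (PiLp.norm_apply_le v 0) (norm_nonneg _))
      _ = _ := one_mul _)

/-- The operator `β(b)` on `F_U(H)`, the extension of `T ⊗ x ↦ b T ⊗ x`. -/
def actCLM (h : IsTROEquivalence A B M) (X : NormalRep A) (b : B) :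
    FUSpace h X →L[ℂ] FUSpace h X :=
  (preAct h X b).completion

theorem actCLM_tmul (h : IsTROEquivalence A B M) (X : NormalRep A) (b : B)
    (T : bimodU B M) (x : X.carrier) :
    actCLM h X b (FUSpace.tmul h X T x) = FUSpace.tmul h X (mulU b T) x :=
  ContinuousLinearMap.completion_apply_coe _ _

theorem FUSpace.tmul_add_left (h : IsTROEquivalence A B M) (X : NormalRep A)
    (T T' : bimodU B M) (x : X.carrier) :
    FUSpace.tmul h X (T + T') x = FUSpace.tmul h X T x + FUSpace.tmul h X T' x := by
  have := TensorProduct.add_tmul (R := ℂ) T T' x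
  have h2 := congrArg (fun z : (bimodU B M) ⊗[ℂ] X.carrier =>
    UniformSpace.Completion.toComplL (𝕜 := ℂ) (E := PreFU h X) z) this
  exact h2.trans (map_add (UniformSpace.Completion.toComplL (𝕜 := ℂ) (E := PreFU h X)) _ _)

theorem FUSpace.tmul_smul_left (h : IsTROEquivalence A B M) (X : NormalRep A)
    (c : ℂ) (T : bimodU B M) (x : X.carrier) :
    FUSpace.tmul h X (c • T) x = c • FUSpace.tmul h X T x := by
  have := TensorProduct.smul_tmul' (R := ℂ) c T x
  have h2 := congrArg (fun z : (bimodU B M) ⊗[ℂ] X.carrier =>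
    UniformSpace.Completion.toComplL (𝕜 := ℂ) (E := PreFU h X) z) this.symm
  exact h2.trans (map_smul (UniformSpace.Completion.toComplL (𝕜 := ℂ) (E := PreFU h X)) _ _)

/-- The representation `β : B → B(F_U(H))`. -/
def actRep (h : IsTROEquivalence A B M) (X : NormalRep A) :
    B →ₐ[ℂ] (FUSpace h X →L[ℂ] FUSpace h X) :=
  AlgHom.ofLinearMap
    { toFun := actCLM h X
      map_add' := fun b c => FUSpace.hom_ext fun T x => by
        have e : mulU (b + c) T = mulU b T + mulU c T := by
          ext; simp [mulU, compLeft, LinearMap.restrict]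
        rw [add_apply, actCLM_tmul, actCLM_tmul, actCLM_tmul, e, FUSpace.tmul_add_left]
      map_smul' := fun c b => FUSpace.hom_ext fun T x => by
        have e : mulU (c • b) T = c • mulU b T := by
          ext; simp [mulU, compLeft, LinearMap.restrict]
        rw [smul_apply, RingHom.id_apply, actCLM_tmul, actCLM_tmul, e, FUSpace.tmul_smul_left] }
    (FUSpace.hom_ext fun T x => by
      change actCLM h X 1 _ = _
      rw [actCLM_tmul]
      rfl)
    (fun b c => FUSpace.hom_ext fun T x => by
      change actCLM h X (b * c) _ = actCLM h X b (actCLM h X c _)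
      rw [actCLM_tmul, actCLM_tmul, actCLM_tmul]
      rfl)

/-- `T ⊗ x ↦ T ⊗ f(x)`, for an `A`-module map `f`. -/
def preMap (h : IsTROEquivalence A B M) {X Y : NormalRep A} (f : NormalRep.Hom X Y) :
    PreFU h X →L[ℂ] PreFU h Y :=
  LinearMap.mkContinuous
    (show (bimodU B M) ⊗[ℂ] X.carrier →ₗ[ℂ] (bimodU B M) ⊗[ℂ] Y.carrier from
      f.toCLM.toLinearMap.lTensor (bimodU B M)) ‖f.toCLM‖ (fun z => by
    change supNorm h Y (f.toCLM.toLinearMap.lTensor (bimodU B M) z) ≤ ‖f.toCLM‖ * supNorm h X z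
    refine ciSup_le fun S => ?_
    have e : ∀ i, PiLp.projₗ (𝕜 := ℂ) 2 (fun _ : Fin S.1 => Y.carrier) i ∘ₗ
        colEval h Y S.2.1 ∘ₗ f.toCLM.toLinearMap.lTensor (bimodU B M) =
        f.toCLM.toLinearMap ∘ₗ PiLp.projₗ (𝕜 := ℂ) 2 (fun _ : Fin S.1 => X.carrier) i ∘ₗ
          colEval h X S.2.1 := by
      intro i
      refine TensorProduct.ext' fun T x => ?_
      have hc := DFunLike.congr_fun (f.comm ⟨(S.2.1 i : K₀ →L[ℂ] H₀) ∘L (T : H₀ →L[ℂ] K₀),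
        h.comp_mem (S.2.1 i).2 T.2⟩) x
      simpa [colEval_tmul] using hc.symm
    have e' : ∀ i, colEval h Y S.2.1 (f.toCLM.toLinearMap.lTensor (bimodU B M) z) i
        = f.toCLM (colEval h X S.2.1 z i) := fun i => LinearMap.congr_fun (e i) z
    refine le_trans ?_ (mul_le_mul_of_nonneg_left (le_supNorm h X S z) (norm_nonneg _))
    refine le_of_sq_le_sq ?_ (by positivity)
    rw [mul_pow, PiLp.norm_sq_eq_of_L2, PiLp.norm_sq_eq_of_L2, Finset.mul_sum]
    refine Finset.sum_le_sum fun i _ => ?_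
    rw [e', ← mul_pow]
    exact pow_le_pow_left₀ (norm_nonneg _) (f.toCLM.le_opNorm _) 2)

/-- The operator `F_U(f) : F_U(X) → F_U(Y)`, the extension of `T ⊗ x ↦ T ⊗ f(x)`. -/
def mapCLM (h : IsTROEquivalence A B M) {X Y : NormalRep A} (f : NormalRep.Hom X Y) :
    FUSpace h X →L[ℂ] FUSpace h Y :=
  (preMap h f).completion

theorem mapCLM_tmul (h : IsTROEquivalence A B M) {X Y : NormalRep A} (f : NormalRep.Hom X Y)
    (T : bimodU B M) (x : X.carrier) :
    mapCLM h f (FUSpace.tmul h X T x) = FUSpace.tmul h Y T (f.toCLM x) :=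
  ContinuousLinearMap.completion_apply_coe _ _

/-- The assertion that the construction `H ↦ (F_U(H), β)` produces normal representations of
`B`: the norm of `F_U(H)` satisfies the parallelogram identity, so that `F_U(H)` is a Hilbert
space for the inner product obtained by polarization, and `β` is completely contractive and
w*-continuous. -/
structure FUWellDefined (h : IsTROEquivalence A B M) : Prop where
  parallelogram : ∀ X : NormalRep A, InnerProductSpaceable (FUSpace h X)
  completelyContractive : ∀ X : NormalRep A, IsCompletelyContractive (actRep h X)
  wstarContinuous : ∀ X : NormalRep A,
    letI : InnerProductSpace ℂ (FUSpace h X) :=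
      InnerProductSpace.ofNorm ℂ (parallelogram X).parallelogram_identity
    IsWStarContinuous (actRep h X)

/-- The object `(F_U(H), β)` of `_B M`. -/
def FUObj {h : IsTROEquivalence A B M} (w : FUWellDefined h) (X : NormalRep A) : NormalRep B :=
  letI : InnerProductSpace ℂ (FUSpace h X) :=
    InnerProductSpace.ofNorm ℂ (w.parallelogram X).parallelogram_identity
  { carrier := FUSpace h X
    rep := actRep h X
    completelyContractive := w.completelyContractive X
    wstarContinuous := w.wstarContinuous X }

/-- The functor `F_U : _A M → _B M`. -/
def FU {h : IsTROEquivalence A B M} (w : FUWellDefined h) :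
    CategoryTheory.Functor (NormalRep A) (NormalRep B) where
  obj X := FUObj w X
  map {X Y} f :=
    { toCLM := (mapCLM h f : FUSpace h X →L[ℂ] FUSpace h Y)
      comm := fun b => FUSpace.hom_ext fun T x => by
        change mapCLM h f (actCLM h X b _) = actCLM h Y b (mapCLM h f _)
        rw [actCLM_tmul, mapCLM_tmul, mapCLM_tmul, actCLM_tmul] }
  map_id X := NormalRep.Hom.ext (FUSpace.hom_ext fun T x => mapCLM_tmul h _ T x)
  map_comp {X Y Z} f g := NormalRep.Hom.ext (FUSpace.hom_ext fun T x => by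
    change mapCLM h _ _ = mapCLM h g (mapCLM h f _)
    rw [mapCLM_tmul, mapCLM_tmul, mapCLM_tmul]
    rfl)

end TRO

end DualOpAlg

end

noncomputable section

namespace DualOpAlg

/-! ### The predual of a w*-closed space of operators -/

section L1

variable {I D : Type*} [NormedAddCommGroup D] [NormedSpace ℂ D] [CompleteSpace D]

theorem summable_l1_smul (ω : I → D) (hω : ∀ i, ‖ω i‖ ≤ 1) (c : lp (fun _ : I => ℂ) 1) :
    Summable fun i => c i • ω i := by
  have hc : Summable fun i => ‖c i‖ := by simpa using c.2.summable
  refine Summable.of_norm_bounded hc fun i => ?_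
  rw [norm_smul]
  exact mul_le_of_le_one_right (norm_nonneg _) (hω i)

/-- The contraction `ℓ¹(I) → D` which extends a family in the unit ball of `D`. -/
def l1Lift (ω : I → D) (hω : ∀ i, ‖ω i‖ ≤ 1) : lp (fun _ : I => ℂ) 1 →L[ℂ] D :=
  LinearMap.mkContinuous
    { toFun := fun c => ∑' i, c i • ω i
      map_add' := fun c d => by
        simp only [lp.coeFn_add, Pi.add_apply, add_smul]
        exact (summable_l1_smul ω hω c).tsum_add (summable_l1_smul ω hω d)
      map_smul' := fun a c => by
        simp only [lp.coeFn_smul, Pi.smul_apply, smul_assoc, RingHom.id_apply]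
        exact (summable_l1_smul ω hω c).tsum_const_smul a }
    1 (fun c => by
      have hc : Summable fun i => ‖c i‖ := by simpa using c.2.summable
      have hn : ∑' i, ‖c i‖ = ‖c‖ := by
        rw [lp.norm_eq_tsum_rpow (by simp)]
        simp
      rw [one_mul, ← hn]
      exact tsum_of_norm_bounded hc.hasSum fun i => by
        rw [norm_smul]
        exact mul_le_of_le_one_right (norm_nonneg _) (hω i))

theorem hasSum_l1Lift (ω : I → D) (hω : ∀ i, ‖ω i‖ ≤ 1) (c : lp (fun _ : I => ℂ) 1) :
    HasSum (fun i => c i • ω i) (l1Lift ω hω c) :=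
  (summable_l1_smul ω hω c).hasSum

theorem l1Lift_single [DecidableEq I] (ω : I → D) (hω : ∀ i, ‖ω i‖ ≤ 1) (i : I) (a : ℂ) :
    l1Lift ω hω (lp.single 1 i a) = a • ω i := by
  refine (hasSum_l1Lift ω hω _).unique ?_
  have h := hasSum_single (f := fun j => (lp.single 1 i a : lp (fun _ : I => ℂ) 1) j • ω j) i
    (fun j hj => by simp [Pi.single_eq_of_ne hj])
  simpa using h

end L1

section Predual

variable {E F : Type*}
  [NormedAddCommGroup E] [InnerProductSpace ℂ E]
  [NormedAddCommGroup F] [InnerProductSpace ℂ F]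

/-- The vector functional `T ↦ ⟨y, T x⟩` of `B(E, F)`. -/
def vecFunctional (x : E) (y : F) : (E →L[ℂ] F) →L[ℂ] ℂ :=
  innerSL ℂ y ∘L ContinuousLinearMap.apply ℂ F x

@[simp]
theorem vecFunctional_apply (x : E) (y : F) (T : E →L[ℂ] F) :
    vecFunctional x y T = ⟪y, T x⟫_ℂ := rfl

theorem norm_vecFunctional_le (x : E) (y : F) : ‖vecFunctional x y‖ ≤ ‖x‖ * ‖y‖ := by
  refine ContinuousLinearMap.opNorm_le_bound _ (by positivity) fun T => ?_
  calc ‖⟪y, T x⟫_ℂ‖ ≤ ‖y‖ * (‖T‖ * ‖x‖) :=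
        (norm_inner_le_norm _ _).trans
          (mul_le_mul_of_nonneg_left (T.le_opNorm _) (norm_nonneg _))
    _ = _ := by ring

theorem continuous_wstarEval (p : SqSummablePair E F) :
    Continuous[wstarTopology E F, inferInstance] fun T => wstarEval E F T p := by
  let : TopologicalSpace (E →L[ℂ] F) := wstarTopology E F
  exact (continuous_apply p).comp (continuous_induced_dom (f := wstarEval E F))

/-- The pair of sequences with a single nonzero entry, which represents `T ↦ ⟨y, T x⟩`. -/
def singlePair (x : E) (y : F) : SqSummablePair E F :=
  ⟨(Pi.single 0 x, Pi.single 0 y),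
    summable_of_ne_finset_zero (s := {0}) fun n hn => by
      have : n ≠ 0 := by simpa using hn
      simp [this],
    summable_of_ne_finset_zero (s := {0}) fun n hn => by
      have : n ≠ 0 := by simpa using hn
      simp [this]⟩

theorem wstarEval_singlePair (x : E) (y : F) (T : E →L[ℂ] F) :
    wstarEval E F T (singlePair x y) = ⟪y, T x⟫_ℂ := by
  change ∑' n, ⟪(Pi.single 0 y : ℕ → F) n, T ((Pi.single 0 x : ℕ → E) n)⟫_ℂ = _
  rw [tsum_eq_single 0]
  · simp
  · intro n hn
    simp [hn]

theorem wstar_continuous_inner (x : E) (y : F) :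
    Continuous[wstarTopology E F, inferInstance] fun T : E →L[ℂ] F => ⟪y, T x⟫_ℂ := by
  have h := continuous_wstarEval (singlePair x y)
  simpa only [wstarEval_singlePair] using h

/-- Pairs of vectors in the unit balls. -/
abbrev BallPair (E F : Type*) [NormedAddCommGroup E] [NormedAddCommGroup F] : Type _ :=
  {p : E × F // ‖p.1‖ ≤ 1 ∧ ‖p.2‖ ≤ 1}

/-- The map `c ↦ ∑ cᵢ ⟨yᵢ, · xᵢ⟩`, from `ℓ¹` over the pairs of unit ball vectors to the
functionals of `B(E, F)`. -/
def nuclear (E F : Type*) [NormedAddCommGroup E] [InnerProductSpace ℂ E]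
    [NormedAddCommGroup F] [InnerProductSpace ℂ F] :
    lp (fun _ : BallPair E F => ℂ) 1 →L[ℂ] ((E →L[ℂ] F) →L[ℂ] ℂ) :=
  l1Lift (fun i : BallPair E F => vecFunctional i.1.1 i.1.2) fun i =>
    (norm_vecFunctional_le _ _).trans (mul_le_one₀ i.2.1 (norm_nonneg _) i.2.2)

open Classical in
/-- An element of `ℓ¹` that represents the functional `⟨y, · x⟩`. -/
def rankOne (x : E) (y : F) : lp (fun _ : BallPair E F => ℂ) 1 :=
  lp.single 1 (⟨(((‖x‖⁻¹ : ℝ) : ℂ) • x, ((‖y‖⁻¹ : ℝ) : ℂ) • y), by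
    constructor <;> rw [norm_smul, Complex.norm_real, norm_inv, norm_norm] <;>
      exact inv_mul_le_one⟩ : BallPair E F) ((‖x‖ * ‖y‖ : ℝ) : ℂ)

theorem norm_rankOne_le (x : E) (y : F) : ‖rankOne x y‖ ≤ ‖x‖ * ‖y‖ := by
  classical
  rw [rankOne, lp.norm_single one_pos, Complex.norm_real, Real.norm_of_nonneg (by positivity)]

theorem nuclear_rankOne (x : E) (y : F) : nuclear E F (rankOne x y) = vecFunctional x y := by
  classical
  rw [nuclear, rankOne, l1Lift_single]
  ext T
  by_cases hx : x = 0
  · simp [hx]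
  by_cases hy : y = 0
  · simp [hy]
  have hx' : (‖x‖ : ℂ) ≠ 0 := by simpa using hx
  have hy' : (‖y‖ : ℂ) ≠ 0 := by simpa using hy
  simp only [smul_apply, vecFunctional_apply, map_smul, inner_smul_left, inner_smul_right,
    smul_eq_mul]
  simp
  field_simp

/-- Every w*-continuous functional `T ↦ ∑ ⟨yₙ, T xₙ⟩` comes from `ℓ¹`. -/
theorem exists_nuclear_eq (p : SqSummablePair E F) :
    ∃ c, ∀ T, nuclear E F c T = wstarEval E F T p := by
  have hs : Summable fun n => rankOne (p.1.1 n) (p.1.2 n) := by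
    refine Summable.of_norm_bounded (g := fun n => ‖p.1.1 n‖ ^ 2 + ‖p.1.2 n‖ ^ 2)
      (p.2.1.add p.2.2) fun n => (norm_rankOne_le _ _).trans ?_
    nlinarith [sq_nonneg (‖p.1.1 n‖ - ‖p.1.2 n‖), sq_nonneg ‖p.1.1 n‖, sq_nonneg ‖p.1.2 n‖]
  refine ⟨∑' n, rankOne (p.1.1 n) (p.1.2 n), fun T => ?_⟩
  have h1 := (hs.hasSum.mapL (nuclear E F)).mapL (ContinuousLinearMap.apply ℂ ℂ T)
  simp only [nuclear_rankOne, ContinuousLinearMap.apply_apply, vecFunctional_apply] at h1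
  exact h1.tsum_eq.symm

/-- The functionals which come from `ℓ¹` are of the form `T ↦ ∑ ⟨yₙ, T xₙ⟩`. -/
theorem exists_wstarEval_eq (c : lp (fun _ : BallPair E F => ℂ) 1) :
    ∃ p, ∀ T, nuclear E F c T = wstarEval E F T p := by
  classical
  have hc : Summable fun i => ‖c i‖ := by simpa using c.2.summable
  let s : Set (BallPair E F) := Function.support fun i => ‖c i‖
  have hsc : s.Countable := hc.countable_support
  have : Countable s := hsc.to_subtype
  obtain ⟨e, he⟩ := exists_injective_nat s
  let r : s → ℂ := fun i => ((Real.sqrt ‖c i‖ : ℝ) : ℂ)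
  have hr : ∀ i, ‖r i‖ ^ 2 = ‖c i‖ := fun i => by
    simp only [r]
    rw [Complex.norm_real, Real.norm_of_nonneg (Real.sqrt_nonneg _), Real.sq_sqrt (norm_nonneg _)]
  have hr0 : ∀ i, r i ≠ 0 := fun i h0 => i.2 (by
    have := hr i
    rw [h0] at this
    simpa using this.symm)
  let X : ℕ → E := Function.extend e (fun i => (c i / r i) • i.1.1.1) 0
  let Y : ℕ → F := Function.extend e (fun i => r i • i.1.1.2) 0
  have hX : ∀ i, X (e i) = (c i / r i) • i.1.1.1 := fun i => he.extend_apply _ _ _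
  have hY : ∀ i, Y (e i) = r i • i.1.1.2 := fun i => he.extend_apply _ _ _
  have hX0 : ∀ n, n ∉ Set.range e → X n = 0 := fun n hn =>
    Function.extend_apply' _ _ _ (by simpa using hn)
  have hY0 : ∀ n, n ∉ Set.range e → Y n = 0 := fun n hn =>
    Function.extend_apply' _ _ _ (by simpa using hn)
  have hcs : Summable fun i : s => ‖c i‖ := hc.subtype s
  have h1 : Summable fun n => ‖X n‖ ^ 2 := by
    rw [← he.summable_iff fun n hn => by simp [hX0 n hn]]
    refine Summable.of_nonneg_of_le (fun _ => sq_nonneg _) (fun i => ?_) hcs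
    simp only [Function.comp_apply, hX, norm_smul, norm_div, mul_pow, div_pow, hr]
    have : ‖c i‖ ^ 2 / ‖c i‖ = ‖c i‖ := by
      have : ‖c i‖ ≠ 0 := i.2
      field_simp
    rw [this]
    exact mul_le_of_le_one_right (norm_nonneg _) (pow_le_one₀ (norm_nonneg _) i.1.2.1)
  have h2 : Summable fun n => ‖Y n‖ ^ 2 := by
    rw [← he.summable_iff fun n hn => by simp [hY0 n hn]]
    refine Summable.of_nonneg_of_le (fun _ => sq_nonneg _) (fun i => ?_) hcs
    simp only [Function.comp_apply, hY, norm_smul, mul_pow, hr]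
    exact mul_le_of_le_one_right (norm_nonneg _) (pow_le_one₀ (norm_nonneg _) i.1.2.2)
  refine ⟨⟨(X, Y), h1, h2⟩, fun T => ?_⟩
  have h3 := (hasSum_l1Lift (fun i : BallPair E F => vecFunctional i.1.1 i.1.2) (fun i =>
    (norm_vecFunctional_le _ _).trans (mul_le_one₀ i.2.1 (norm_nonneg _) i.2.2)) c).mapL
    (ContinuousLinearMap.apply ℂ ℂ T)
  change _ = ∑' n, ⟪Y n, T (X n)⟫_ℂ
  refine h3.tsum_eq.symm.trans ?_
  rw [← he.tsum_eq (f := fun n => ⟪Y n, T (X n)⟫_ℂ), ← Subtype.coe_injective.tsum_eq (g := ((↑) : s → BallPair E F))]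
  · refine tsum_congr fun i => ?_
    have hrr : (starRingEnd ℂ) (r i) = r i := Complex.conj_ofReal _
    have e1 : ⟪Y (e i), T (X (e i))⟫_ℂ = c i * ⟪i.1.1.2, T i.1.1.1⟫_ℂ := by
      rw [hX, hY, T.map_smul, inner_smul_left, inner_smul_right, hrr, mul_left_comm, ← mul_assoc,
        div_mul_cancel₀ _ (hr0 i)]
    exact e1.symm
  · intro i hi
    have : c i ≠ 0 := fun h0 => hi (by simp [h0])
    exact ⟨⟨i, by simpa [s] using this⟩, rfl⟩
  · intro n hn
    by_contra hcon
    exact hn (by simp [hX0 n hcon])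

/-- A point outside a w*-closed subspace is separated from it by a w*-continuous functional. -/
theorem exists_wstarEval_ne_zero {W : Submodule ℂ (E →L[ℂ] F)}
    (hW : IsClosed[wstarTopology E F] (W : Set (E →L[ℂ] F))) {T : E →L[ℂ] F} (hT : T ∉ W) :
    ∃ c, (∀ S ∈ W, nuclear E F c S = 0) ∧ nuclear E F c T ≠ 0 := by
  classical
  obtain ⟨C, hC, hCW⟩ := isClosed_induced_iff.1 hW
  have hTC : wstarEval E F T ∈ Cᶜ := fun h => hT (by
    have : T ∈ wstarEval E F ⁻¹' C := h
    rwa [hCW] at this)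
  obtain ⟨s, v, hv, hsv⟩ := isOpen_pi_iff.1 hC.isOpen_compl _ hTC
  let L : (E →L[ℂ] F) →ₗ[ℂ] (s → ℂ) :=
    LinearMap.pi fun p => LinearMap.proj (p : SqSummablePair E F) ∘ₗ wstarEval E F
  have hL : L T ∉ W.map L := by
    rintro ⟨S, hS, hST⟩
    have h1 : wstarEval E F S ∈ Cᶜ := hsv fun p hp => by
      have := congrFun hST ⟨p, hp⟩
      change wstarEval E F S p = wstarEval E F T p at this
      rw [this]
      exact (hv p hp).2
    have h2 : S ∈ wstarEval E F ⁻¹' C := by rwa [hCW]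
    exact h1 h2
  obtain ⟨f, hf, hfW⟩ := Submodule.exists_le_ker_of_notMem hL
  choose c hc using exists_nuclear_eq (E := E) (F := F)
  have key : ∀ S, nuclear E F (∑ p : s, f (Pi.single p 1) • c p) S = f (L S) := by
    intro S
    rw [map_sum, sum_apply, LinearMap.pi_apply_eq_sum_univ f (L S)]
    refine Finset.sum_congr rfl fun p _ => ?_
    rw [map_smul, smul_apply, hc, smul_eq_mul, smul_eq_mul, mul_comm]
    congr 2
    ext q
    simp [Pi.single_apply, eq_comm]
  exact ⟨_, fun S hS => (key S).trans (hfW ⟨S, hS, rfl⟩), fun h0 => hf ((key T).symm.trans h0)⟩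

variable {V : Type*} [NormedAddCommGroup V] [NormedSpace ℂ V]

/-- The restriction of the functionals from `ℓ¹` to a space of operators. -/
def nuclearOn (j : V →ₗᵢ[ℂ] (E →L[ℂ] F)) :
    lp (fun _ : BallPair E F => ℂ) 1 →L[ℂ] (V →L[ℂ] ℂ) :=
  l1Lift (fun i : BallPair E F => vecFunctional i.1.1 i.1.2 ∘L j.toContinuousLinearMap) fun i => by
    refine ContinuousLinearMap.opNorm_le_bound _ zero_le_one fun T => ?_
    rw [← j.norm_map T]
    exact (vecFunctional i.1.1 i.1.2).le_of_opNorm_le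
      ((norm_vecFunctional_le _ _).trans (mul_le_one₀ i.2.1 (norm_nonneg _) i.2.2)) _

theorem nuclearOn_apply (j : V →ₗᵢ[ℂ] (E →L[ℂ] F)) (c : lp (fun _ : BallPair E F => ℂ) 1)
    (T : V) : nuclearOn j c T = nuclear E F c (j T) := by
  have h1 := (hasSum_l1Lift _ _ c : HasSum _ (nuclearOn j c)).mapL
    (ContinuousLinearMap.apply ℂ ℂ T)
  have h2 := (hasSum_l1Lift _ _ c : HasSum _ (nuclear E F c)).mapL
    (ContinuousLinearMap.apply ℂ ℂ (j T))
  simp only [map_smul, ContinuousLinearMap.apply_apply, ContinuousLinearMap.comp_apply] at h1 h2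
  exact h1.unique h2

/-- The w*-continuous functionals of a space of operators are the restrictions of functionals
from `ℓ¹`. -/
theorem wstarContinuous_iff_mem_range (j : V →ₗᵢ[ℂ] (E →L[ℂ] F)) (f : V →L[ℂ] ℂ) :
    Continuous[TopologicalSpace.induced j (wstarTopology E F), inferInstance] f ↔
      f ∈ Set.range (nuclearOn j) := by
  constructor
  · intro hf
    let g : SqSummablePair E F → V →ₗ[ℂ] ℂ := fun p =>
      LinearMap.proj p ∘ₗ wstarEval E F ∘ₗ j.toLinearMap
    have h1 : f.toLinearMap ∈ Submodule.span ℂ (Set.range g) := by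
      rw [LinearMap.mem_span_iff_continuous]
      have e : TopologicalSpace.induced j (wstarTopology E F) =
          ⨅ p, TopologicalSpace.induced (g p) inferInstance := by
        rw [wstarTopology, induced_compose, Pi.topologicalSpace, induced_iInf]
        refine iInf_congr fun p => ?_
        rw [induced_compose]
        rfl
      rw [← e]
      exact hf
    have h2 : Submodule.span ℂ (Set.range g) ≤
        (LinearMap.range (nuclearOn j).toLinearMap).map (ContinuousLinearMap.coeLM ℂ) := by
      rw [Submodule.span_le]
      rintro _ ⟨p, rfl⟩
      obtain ⟨c, hc⟩ := exists_nuclear_eq p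
      exact ⟨nuclearOn j c, ⟨c, rfl⟩, LinearMap.ext fun T => (nuclearOn_apply j c T).trans (hc _)⟩
    obtain ⟨f', ⟨c, hc⟩, e⟩ := h2 h1
    exact ⟨c, hc.trans (ContinuousLinearMap.coe_injective e)⟩
  · rintro ⟨c, rfl⟩
    obtain ⟨p, hp⟩ := exists_wstarEval_eq c
    let : TopologicalSpace (E →L[ℂ] F) := wstarTopology E F
    let : TopologicalSpace V := TopologicalSpace.induced j (wstarTopology E F)
    have h : Continuous fun T : V => wstarEval E F (j T) p :=
      (continuous_wstarEval p).comp continuous_induced_dom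
    exact h.congr fun T => ((nuclearOn_apply j c T).trans (hp _)).symm

/-- A bounded functional on `ℓ¹` which only depends on the represented functional is the
evaluation at an operator. -/
theorem exists_operator_of_dual [CompleteSpace E] [CompleteSpace F]
    (g : lp (fun _ : BallPair E F => ℂ) 1 →L[ℂ] ℂ)
    (hg : ∀ c, nuclear E F c = 0 → g c = 0) :
    ∃ T : E →L[ℂ] F, ‖T‖ ≤ ‖g‖ ∧ ∀ c, g c = nuclear E F c T := by
  have hg' : ∀ c d, nuclear E F c = nuclear E F d → g c = g d := fun c d h => by
    rw [← sub_eq_zero, ← map_sub]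
    exact hg _ (by rw [map_sub, h, sub_self])
  have hb : ∀ (y : F) (x : E), ‖g (rankOne x y)‖ ≤ ‖g‖ * ‖y‖ * ‖x‖ := fun y x => by
    refine (g.le_opNorm _).trans ?_
    rw [mul_assoc, mul_comm ‖y‖]
    exact mul_le_mul_of_nonneg_left (norm_rankOne_le x y) (norm_nonneg _)
  let b : F →ₗ⋆[ℂ] E →ₗ[ℂ] ℂ := LinearMap.mk₂'ₛₗ (starRingEnd ℂ) (RingHom.id ℂ)
    (fun y x => g (rankOne x y))
    (fun y y' x => by
      rw [← map_add]
      refine hg' _ _ ?_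
      ext T
      simp [nuclear_rankOne])
    (fun a y x => by
      rw [← map_smul]
      refine hg' _ _ ?_
      ext T
      simp [nuclear_rankOne, mul_comm])
    (fun y x x' => by
      rw [← map_add]
      refine hg' _ _ ?_
      ext T
      simp [nuclear_rankOne])
    (fun a y x => by
      rw [RingHom.id_apply, ← map_smul]
      refine hg' _ _ ?_
      ext T
      simp [nuclear_rankOne])
  let b' : F →L⋆[ℂ] E →L[ℂ] ℂ := b.mkContinuous₂ ‖g‖ hb
  let R : F →L[ℂ] E := ((InnerProductSpace.toDual ℂ E).symm : (E →L[ℂ] ℂ) →L⋆[ℂ] E) ∘SL b'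
  have hR : ∀ y x, ⟪R y, x⟫_ℂ = g (rankOne x y) := fun y x =>
    InnerProductSpace.toDual_symm_apply
  refine ⟨ContinuousLinearMap.adjoint R, ?_, fun c => ?_⟩
  · rw [LinearIsometryEquiv.norm_map]
    refine ContinuousLinearMap.opNorm_le_bound _ (norm_nonneg _) fun y => ?_
    have : ‖R y‖ = ‖b' y‖ := (InnerProductSpace.toDual ℂ E).symm.norm_map (b' y)
    rw [this]
    refine ContinuousLinearMap.opNorm_le_bound _ (by positivity) fun x => hb y x
  · classical
    have h1 := (lp.hasSum_single (p := 1) (by simp) c).mapL g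
    have h2 := ((lp.hasSum_single (p := 1) (by simp) c).mapL (nuclear E F)).mapL
      (ContinuousLinearMap.apply ℂ ℂ (ContinuousLinearMap.adjoint R))
    refine h1.unique ?_
    convert! h2 using 2 with i
    have e : nuclear E F (lp.single 1 i (c i)) = nuclear E F (c i • rankOne i.1.1 i.1.2) := by
      rw [map_smul, nuclear_rankOne, nuclear, l1Lift_single]
    rw [hg' _ _ e, e, map_smul, map_smul, nuclear_rankOne]
    simp [ContinuousLinearMap.adjoint_inner_right, hR]

/-- The predual of a w*-closed space of operators is complete: the w*-continuous functionals are
norm closed in the dual space. -/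
theorem isClosed_setOf_wstarContinuous [CompleteSpace E] [CompleteSpace F]
    (j : V →ₗᵢ[ℂ] (E →L[ℂ] F))
    (hj : IsClosed[wstarTopology E F] (LinearMap.range j.toLinearMap : Set (E →L[ℂ] F))) :
    IsClosed {f : V →L[ℂ] ℂ |
      Continuous[TopologicalSpace.induced j (wstarTopology E F), inferInstance] f} := by
  simp only [wstarContinuous_iff_mem_range]
  let N : Submodule ℂ (lp (fun _ : BallPair E F => ℂ) 1) := LinearMap.ker (nuclearOn j).toLinearMap
  have : IsClosed (N : Set (lp (fun _ : BallPair E F => ℂ) 1)) := (nuclearOn j).isClosed_ker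
  let q : (lp (fun _ : BallPair E F => ℂ) 1 ⧸ N) →L[ℂ] (V →L[ℂ] ℂ) :=
    N.liftQL (nuclearOn j) le_rfl
  have hq : ∀ c, q (N.mkQ c) = nuclearOn j c := fun c => rfl
  have hbound : ∀ z, ‖z‖ ≤ 1 * ‖q z‖ := by
    intro z
    obtain ⟨c, rfl⟩ := N.mkQ_surjective z
    obtain ⟨g, hg1, hg⟩ := exists_dual_vector'' ℂ (N.mkQ c)
    let g' : lp (fun _ : BallPair E F => ℂ) 1 →L[ℂ] ℂ := g ∘L N.mkQL
    have hker : ∀ d, nuclearOn j d = 0 → g' d = 0 := fun d hd => by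
      have : N.mkQ d = 0 := (Submodule.Quotient.mk_eq_zero N).2 hd
      change g (N.mkQ d) = 0
      rw [this, map_zero]
    obtain ⟨T, hT, hTg⟩ := exists_operator_of_dual g' fun d hd => hker d (by
      ext S
      rw [nuclearOn_apply, hd]
      rfl)
    have hT1 : ‖T‖ ≤ 1 := by
      refine hT.trans (ContinuousLinearMap.opNorm_le_bound _ zero_le_one fun d => ?_)
      refine (g.le_of_opNorm_le hg1 _).trans ?_
      exact mul_le_mul_of_nonneg_left (Submodule.Quotient.norm_mk_le N d) zero_le_one
    have hTW : T ∈ LinearMap.range j.toLinearMap := by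
      by_contra hcon
      obtain ⟨d, hd, hdT⟩ := exists_wstarEval_ne_zero hj hcon
      refine hdT ?_
      rw [← hTg]
      exact hker d (ContinuousLinearMap.ext fun S =>
        (nuclearOn_apply j d S).trans (hd _ ⟨S, rfl⟩))
    obtain ⟨S, rfl⟩ := hTW
    have h1 : g (N.mkQ c) = nuclearOn j c S := (hTg c).trans (nuclearOn_apply j c S).symm
    have h2 : ‖N.mkQ c‖ = ‖g (N.mkQ c)‖ := by rw [hg]; simp
    rw [h2, h1, hq, one_mul]
    refine ((nuclearOn j c).le_opNorm _).trans ?_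
    exact mul_le_of_le_one_right (norm_nonneg _) ((j.norm_map S).symm.trans_le hT1)
  have hanti : AntilipschitzWith 1 q := AddMonoidHomClass.antilipschitz_of_bound q
    (by simpa using hbound)
  have hr : {f | f ∈ Set.range (nuclearOn j)} = Set.range q := by
    ext f
    constructor
    · rintro ⟨c, rfl⟩
      exact ⟨N.mkQ c, rfl⟩
    · rintro ⟨z, rfl⟩
      obtain ⟨c, rfl⟩ := N.mkQ_surjective z
      exact ⟨c, rfl⟩
  rw [hr]
  exact hanti.isClosed_range q.uniformContinuous

/-- The w*-continuous functionals of a space of operators. -/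
def wstarDual (j : V →ₗᵢ[ℂ] (E →L[ℂ] F)) : Submodule ℂ (V →L[ℂ] ℂ) :=
  LinearMap.range (nuclearOn j).toLinearMap

theorem mem_wstarDual (j : V →ₗᵢ[ℂ] (E →L[ℂ] F)) (f : V →L[ℂ] ℂ) : f ∈ wstarDual j ↔
    Continuous[TopologicalSpace.induced j (wstarTopology E F), inferInstance] f :=
  (wstarContinuous_iff_mem_range j f).symm

theorem isClosed_wstarDual [CompleteSpace E] [CompleteSpace F] (j : V →ₗᵢ[ℂ] (E →L[ℂ] F))
    (hj : IsClosed[wstarTopology E F] (LinearMap.range j.toLinearMap : Set (E →L[ℂ] F))) :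
    IsClosed (wstarDual j : Set (V →L[ℂ] ℂ)) := by
  convert isClosed_setOf_wstarContinuous j hj using 1
  ext f
  exact mem_wstarDual j f

theorem continuous_tsum_of_mem_wstarDual [CompleteSpace E] [CompleteSpace F]
    (j : V →ₗᵢ[ℂ] (E →L[ℂ] F))
    (hj : IsClosed[wstarTopology E F] (LinearMap.range j.toLinearMap : Set (E →L[ℂ] F)))
    {f : ℕ → V →L[ℂ] ℂ} (hf : ∀ n, f n ∈ wstarDual j) (hs : Summable f) :
    Continuous[TopologicalSpace.induced j (wstarTopology E F), inferInstance]
      fun v => ∑' n, f n v := by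
  have h1 : ∑' n, f n ∈ wstarDual j := (isClosed_wstarDual j hj).mem_of_tendsto hs.hasSum
    (Filter.Eventually.of_forall fun t => Submodule.sum_mem _ fun n _ => hf n)
  rw [mem_wstarDual] at h1
  have e : (fun v => ∑' n, f n v) = ⇑(∑' n, f n) := funext fun v =>
    (hs.hasSum.mapL (ContinuousLinearMap.apply ℂ ℂ v)).tsum_eq
  rw [e]
  exact h1

end Predual

/-! ### Contractive approximate units from a ternary ring of operators -/

section ApproximateUnit

open Polynomial Filter

/-- Newton's iteration for `t ↦ t^{-1/2}`, as polynomials in `t`. -/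
def newtonPoly : ℕ → ℝ[X]
  | 0 => 1
  | k + 1 => C (1 / 2) * newtonPoly k * (3 - X * newtonPoly k ^ 2)

theorem newtonPoly_bounds (k : ℕ) {t : ℝ} (ht : t ∈ Set.Icc (0 : ℝ) 1) :
    0 ≤ 1 - t * (newtonPoly k).eval t ^ 2 ∧ 1 - t * (newtonPoly k).eval t ^ 2 ≤ (1 - t) ^ (k + 1) := by
  obtain ⟨h0, h1⟩ := ht
  induction k with
  | zero => simp [newtonPoly, h1]
  | succ k ih =>
    obtain ⟨ih1, ih2⟩ := ih
    have e : 1 - t * (newtonPoly (k + 1)).eval t ^ 2 =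
        (1 - t * (newtonPoly k).eval t ^ 2) ^ 2 * (3 + (1 - t * (newtonPoly k).eval t ^ 2)) / 4 := by
      simp only [newtonPoly, eval_mul, eval_C, eval_sub, eval_ofNat, eval_X, eval_pow]
      ring
    rw [e]
    set g := 1 - t * (newtonPoly k).eval t ^ 2
    have hg1 : g ≤ 1 := by
      have : 0 ≤ t * (newtonPoly k).eval t ^ 2 := by positivity
      simp only [g]
      linarith
    have hgt : g ≤ 1 - t := ih2.trans (by
      have := pow_le_pow_of_le_one (sub_nonneg.2 h1) (by linarith) (Nat.le_add_left 1 k)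
      simpa using this)
    refine ⟨by positivity, ?_⟩
    calc g ^ 2 * (3 + g) / 4 ≤ g * g := by nlinarith [sq_nonneg g]
      _ ≤ (1 - t) ^ (k + 1) * (1 - t) := mul_le_mul ih2 hgt ih1 (by
          have : 0 ≤ 1 - t := sub_nonneg.2 h1
          positivity)
      _ = _ := (pow_succ _ _).symm

theorem exists_polynomial_inv_sqrt {δ : ℝ} (hδ : 0 < δ) :
    ∃ p : ℝ[X], ∀ t ∈ Set.Icc (0 : ℝ) 1,
      |t * p.eval t ^ 2| ≤ 1 ∧ |t * (1 - t * p.eval t ^ 2) ^ 2| ≤ δ := by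
  obtain ⟨k, hk⟩ := exists_nat_gt δ⁻¹
  have hk0 : (0 : ℝ) < k := (inv_pos.2 hδ).trans hk
  refine ⟨newtonPoly k, fun t ht => ?_⟩
  obtain ⟨h1, h2⟩ := newtonPoly_bounds k ht
  obtain ⟨ht0, ht1⟩ := ht
  have h3 : 0 ≤ t * (newtonPoly k).eval t ^ 2 := by positivity
  refine ⟨by rw [abs_of_nonneg h3]; linarith, ?_⟩
  set g := 1 - t * (newtonPoly k).eval t ^ 2
  rw [abs_of_nonneg (by positivity)]
  have hg1 : g ≤ 1 := by simp only [g]; linarith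
  have hb : 1 + (k : ℝ) * t ≤ (1 + t) ^ k := one_add_mul_le_pow (by linarith) k
  have hpow : (1 - t) ^ k * (1 + k * t) ≤ 1 := by
    calc (1 - t) ^ k * (1 + k * t) ≤ (1 - t) ^ k * (1 + t) ^ k :=
          mul_le_mul_of_nonneg_left hb (pow_nonneg (sub_nonneg.2 ht1) _)
      _ = (1 - t ^ 2) ^ k := by rw [← mul_pow]; ring
      _ ≤ 1 := pow_le_one₀ (by nlinarith) (by nlinarith)
  have hgk : g ≤ (1 - t) ^ k := h2.trans
    (pow_le_pow_of_le_one (sub_nonneg.2 ht1) (by linarith) (Nat.le_succ k))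
  have h4 : t * (1 - t) ^ k * k ≤ 1 := by
    have : 0 ≤ (1 - t) ^ k := pow_nonneg (sub_nonneg.2 ht1) _
    nlinarith
  have h5 : δ * k > 1 := by
    have := mul_lt_mul_of_pos_left hk hδ
    rwa [mul_inv_cancel₀ hδ.ne'] at this
  have h6 : t * g ^ 2 ≤ t * (1 - t) ^ k :=
    mul_le_mul_of_nonneg_left ((by nlinarith : g ^ 2 ≤ g).trans hgk) ht0
  by_contra hcon
  push Not at hcon
  nlinarith

variable {H K : Type*} [NormedAddCommGroup H] [InnerProductSpace ℂ H] [CompleteSpace H]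
  [NormedAddCommGroup K] [InnerProductSpace ℂ K] [CompleteSpace K]

theorem norm_aeval_le {a : K →L[ℂ] K} (ha : 0 ≤ a) (ha1 : ‖a‖ ≤ 1) {q : ℝ[X]} {c : ℝ} (hc : 0 ≤ c)
    (hq : ∀ t ∈ Set.Icc (0 : ℝ) 1, |q.eval t| ≤ c) : ‖aeval a q‖ ≤ c := by
  have hsa : IsSelfAdjoint a := .of_nonneg ha
  rw [← cfc_polynomial q a hsa]
  refine norm_cfc_le hc fun t ht => hq t ⟨spectrum_nonneg_of_nonneg ha ht, ?_⟩
  have h1 := spectrum.subset_closedBall_norm_mul a ht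
  rw [mem_closedBall_zero_iff] at h1
  calc t ≤ ‖t‖ := le_abs_self t
    _ ≤ ‖a‖ * ‖(1 : K →L[ℂ] K)‖ := h1
    _ ≤ 1 * 1 := mul_le_mul ha1 ContinuousLinearMap.norm_id_le (norm_nonneg _) zero_le_one
    _ = 1 := one_mul 1

theorem isSelfAdjoint_aeval {a : K →L[ℂ] K} (ha : IsSelfAdjoint a) (q : ℝ[X]) :
    IsSelfAdjoint (aeval a q) := by
  rw [← cfc_polynomial q a ha]
  exact cfc_predicate _ _

/-- `∑ mₖ mₖ*` for a finite family of operators. -/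
def sumMulAdjoint {ι : Type*} [Fintype ι] (m : ι → H →L[ℂ] K) : K →L[ℂ] K :=
  ∑ k, m k ∘L ContinuousLinearMap.adjoint (m k)

theorem sumMulAdjoint_apply {ι : Type*} [Fintype ι] (m : ι → H →L[ℂ] K) (y : K) :
    sumMulAdjoint m y = ∑ k, m k (ContinuousLinearMap.adjoint (m k) y) := by
  simp [sumMulAdjoint]

theorem sum_norm_adjoint_sq {ι : Type*} [Fintype ι] (m : ι → H →L[ℂ] K) (y : K) :
    ((∑ k, ‖ContinuousLinearMap.adjoint (m k) y‖ ^ 2 : ℝ) : ℂ) = ⟪y, sumMulAdjoint m y⟫_ℂ := by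
  rw [sumMulAdjoint_apply, inner_sum]
  push_cast
  refine Finset.sum_congr rfl fun k _ => ?_
  rw [← ContinuousLinearMap.adjoint_inner_left, inner_self_eq_norm_sq_to_K]
  rfl

theorem sum_norm_adjoint_sq_le {ι : Type*} [Fintype ι] (m : ι → H →L[ℂ] K) (y : K) :
    ∑ k, ‖ContinuousLinearMap.adjoint (m k) y‖ ^ 2 ≤ ‖y‖ * ‖sumMulAdjoint m y‖ := by
  have h1 := congrArg norm (sum_norm_adjoint_sq m y)
  rw [Complex.norm_real, Real.norm_of_nonneg (by positivity)] at h1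
  rw [h1]
  exact norm_inner_le_norm _ _

theorem sumMulAdjoint_nonneg {ι : Type*} [Fintype ι] (m : ι → H →L[ℂ] K) :
    0 ≤ sumMulAdjoint m := by
  rw [ContinuousLinearMap.nonneg_iff_isPositive]
  exact ContinuousLinearMap.isPositive_sum Finset.univ fun k _ =>
    ContinuousLinearMap.isPositive_self_comp_adjoint (m k)

/-- A column `(mₖ*)` is contractive iff the row `(mₖ)` is; one direction. -/
theorem norm_sum_apply_sq_le {ι : Type*} [Fintype ι] {m : ι → H →L[ℂ] K}
    (hm : ∀ y, ∑ k, ‖ContinuousLinearMap.adjoint (m k) y‖ ^ 2 ≤ ‖y‖ ^ 2) (v : ι → H) :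
    ‖∑ k, m k (v k)‖ ^ 2 ≤ ∑ k, ‖v k‖ ^ 2 := by
  set w := ∑ k, m k (v k) with hw
  have h1 : ‖w‖ ^ 2 ≤ ∑ k, ‖ContinuousLinearMap.adjoint (m k) w‖ * ‖v k‖ := by
    have e : ((‖w‖ ^ 2 : ℝ) : ℂ) = ∑ k, ⟪ContinuousLinearMap.adjoint (m k) w, v k⟫_ℂ := by
      simp only [ContinuousLinearMap.adjoint_inner_left]
      rw [← inner_sum, ← hw, inner_self_eq_norm_sq_to_K]
      norm_cast
    have e2 := congrArg norm e
    rw [Complex.norm_real, Real.norm_of_nonneg (by positivity)] at e2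
    rw [e2]
    exact (norm_sum_le _ _).trans (Finset.sum_le_sum fun k _ => norm_inner_le_norm _ _)
  have h2 := Finset.sum_mul_sq_le_sq_mul_sq Finset.univ
    (fun k => ‖ContinuousLinearMap.adjoint (m k) w‖) (fun k => ‖v k‖)
  have h3 : (‖w‖ ^ 2) ^ 2 ≤ ‖w‖ ^ 2 * ∑ k, ‖v k‖ ^ 2 :=
    (pow_le_pow_left₀ (by positivity) h1 2).trans
      (h2.trans (mul_le_mul_of_nonneg_right (hm w) (by positivity)))
  rcases (norm_nonneg w).eq_or_lt with h0 | h0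
  · rw [← h0, zero_pow two_ne_zero]
    positivity
  · have : 0 < ‖w‖ ^ 2 := by positivity
    rw [sq (‖w‖ ^ 2)] at h3
    exact le_of_mul_le_mul_left h3 this

/-- Finite families in `M` whose adjoints form a contractive column. -/
def ColFamily (M : Submodule ℂ (H →L[ℂ] K)) : Type _ :=
  Σ n : ℕ, {m : Fin n → M //
    ∀ y, ∑ k, ‖ContinuousLinearMap.adjoint (m k : H →L[ℂ] K) y‖ ^ 2 ≤ ‖y‖ ^ 2}

variable {M : Submodule ℂ (H →L[ℂ] K)}

/-- The members of a family. -/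
def ColFamily.op (s : ColFamily M) (k : Fin s.1) : H →L[ℂ] K := s.2.1 k

theorem ColFamily.op_mem (s : ColFamily M) (k : Fin s.1) : s.op k ∈ M := (s.2.1 k).2

theorem ColFamily.sum_adjoint_le (s : ColFamily M) (y : K) :
    ∑ k, ‖ContinuousLinearMap.adjoint (s.op k) y‖ ^ 2 ≤ ‖y‖ ^ 2 := s.2.2 y

/-- The operator `∑ mₖ mₖ*` of a family. -/
def ColFamily.unit (s : ColFamily M) : K →L[ℂ] K := sumMulAdjoint s.op

theorem ColFamily.unit_apply (s : ColFamily M) (y : K) :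
    s.unit y = ∑ k, s.op k (ContinuousLinearMap.adjoint (s.op k) y) := sumMulAdjoint_apply _ _

theorem ColFamily.norm_unit_apply_le (s : ColFamily M) (y : K) : ‖s.unit y‖ ≤ ‖y‖ := by
  refine le_of_sq_le_sq ?_ (norm_nonneg _)
  rw [s.unit_apply]
  exact (norm_sum_apply_sq_le s.sum_adjoint_le _).trans (s.sum_adjoint_le y)

theorem ColFamily.norm_unit_le (s : ColFamily M) : ‖s.unit‖ ≤ 1 :=
  ContinuousLinearMap.opNorm_le_bound _ zero_le_one fun y => by
    rw [one_mul]
    exact s.norm_unit_apply_le y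

theorem aeval_comp_mem {a : K →L[ℂ] K} (ha : ∀ m ∈ M, a ∘L m ∈ M) (p : ℝ[X]) {m : H →L[ℂ] K}
    (hm : m ∈ M) : aeval a p ∘L m ∈ M := by
  have hpow : ∀ k : ℕ, (a ^ k) ∘L m ∈ M := fun k => by
    induction k with
    | zero => exact hm
    | succ k ih =>
      rw [pow_succ']
      exact ha _ ih
  induction p using Polynomial.induction_on' with
  | add p q hp hq =>
    rw [map_add, ContinuousLinearMap.add_comp]
    exact M.add_mem hp hq
  | monomial n r =>
    have e : aeval a (monomial n r) ∘L m = (r : ℂ) • ((a ^ n) ∘L m) := by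
      rw [aeval_monomial]
      ext x
      simp [Algebra.algebraMap_eq_smul_one]
    rw [e]
    exact M.smul_mem _ (hpow n)

/-- For a finite subset of a TRO there is a contractive family `(nₖ)` such that `∑ nₖ nₖ*` is
almost a left unit for it. -/
theorem exists_colFamily_norm_le
    (hM : ∀ a ∈ M, ∀ b ∈ M, ∀ c ∈ M, a ∘L ContinuousLinearMap.adjoint b ∘L c ∈ M)
    (t : Finset M) {δ : ℝ} (hδ : 0 < δ) :
    ∃ s : ColFamily M, ∀ m ∈ t, ‖(1 - s.unit) ∘L (m : H →L[ℂ] K)‖ ≤ δ := by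
  set a₀ : K →L[ℂ] K := sumMulAdjoint fun k : t => ((k : M) : H →L[ℂ] K) with ha₀
  let r : ℝ := (1 + ‖a₀‖)⁻¹
  have hr : 0 < r := by positivity
  have hr1 : r ≤ 1 := inv_le_one_of_one_le₀ (by linarith [norm_nonneg a₀])
  let n : t → H →L[ℂ] K := fun k => (r : ℂ) • ((k : M) : H →L[ℂ] K)
  have hn : ∀ k, n k ∈ M := fun k => M.smul_mem _ (k : M).2
  set a : K →L[ℂ] K := sumMulAdjoint n with ha
  have haM : ∀ m ∈ M, a ∘L m ∈ M := fun m hm => by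
    have : a ∘L m = ∑ k, n k ∘L ContinuousLinearMap.adjoint (n k) ∘L m := by
      ext x
      simp [ha, sumMulAdjoint]
    rw [this]
    exact M.sum_mem fun k _ => hM _ (hn k) _ (hn k) _ hm
  have ha0 : 0 ≤ a := sumMulAdjoint_nonneg n
  have hsa : IsSelfAdjoint a := .of_nonneg ha0
  have hae : a = ((r ^ 2 : ℝ) : ℂ) • a₀ := by
    ext x
    rw [ha, ha₀, sumMulAdjoint_apply, smul_apply, sumMulAdjoint_apply, Finset.smul_sum]
    refine Finset.sum_congr rfl fun k _ => ?_
    simp only [n, map_smulₛₗ, smul_apply, smul_smul]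
    simp [sq]
  have ha1 : ‖a‖ ≤ 1 := by
    rw [hae, norm_smul, Complex.norm_real, Real.norm_of_nonneg (by positivity)]
    calc r ^ 2 * ‖a₀‖ ≤ r * (1 + ‖a₀‖) := by
          have : r ^ 2 ≤ r := by nlinarith
          nlinarith [norm_nonneg a₀]
      _ = 1 := inv_mul_cancel₀ (by positivity)
  obtain ⟨p, hp⟩ := exists_polynomial_inv_sqrt (δ := (r * δ) ^ 2) (by positivity)
  set S : K →L[ℂ] K := aeval a p with hS
  let e := Fintype.equivFin t
  let n' : t → H →L[ℂ] K := fun k => S ∘L n k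
  have hadj : ∀ k y, ContinuousLinearMap.adjoint (n' k) y = ContinuousLinearMap.adjoint (n k) (S y) :=
    fun k y => by
      have h := (isSelfAdjoint_aeval hsa p).adjoint_eq
      simp only [n', ContinuousLinearMap.adjoint_comp, ContinuousLinearMap.comp_apply]
      rw [hS, h]
  have hunit : sumMulAdjoint n' = aeval a (X * p ^ 2) := by
    have e1 : aeval a (X * p ^ 2) = S * (a * S) := by
      rw [show X * p ^ 2 = p * (X * p) by ring, map_mul, map_mul, aeval_X]
    rw [e1]
    ext y
    rw [sumMulAdjoint_apply, mul_apply_eq_comp, mul_apply_eq_comp, ha,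
      sumMulAdjoint_apply, map_sum]
    refine Finset.sum_congr rfl fun k _ => ?_
    rw [hadj]
    rfl
  have hn1 : ‖sumMulAdjoint n'‖ ≤ 1 := by
    rw [hunit]
    exact norm_aeval_le ha0 ha1 zero_le_one fun t ht => by simpa using (hp t ht).1
  let s : ColFamily M := ⟨Fintype.card t,
    fun k => ⟨n' (e.symm k), aeval_comp_mem haM p (hn _)⟩, fun y => by
      change ∑ k, ‖ContinuousLinearMap.adjoint (n' (e.symm k)) y‖ ^ 2 ≤ _
      rw [e.symm.sum_comp fun k => ‖ContinuousLinearMap.adjoint (n' k) y‖ ^ 2]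
      refine (sum_norm_adjoint_sq_le n' y).trans ?_
      rw [sq]
      refine mul_le_mul_of_nonneg_left ?_ (norm_nonneg _)
      simpa using (sumMulAdjoint n').le_of_opNorm_le hn1 y⟩
  have hsu : s.unit = sumMulAdjoint n' :=
    e.symm.sum_comp fun k => n' k ∘L ContinuousLinearMap.adjoint (n' k)
  refine ⟨s, fun m hm => ?_⟩
  set g : ℝ[X] := 1 - X * p ^ 2 with hg
  have hG : 1 - s.unit = aeval a g := by rw [hsu, hunit, hg, map_sub, map_one]
  rw [hG]
  have hGsa := (isSelfAdjoint_aeval hsa g).adjoint_eq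
  set G := aeval a g with hGdef
  have h1 : ∀ y, ‖ContinuousLinearMap.adjoint (n ⟨m, hm⟩) (G y)‖ ≤ (r * δ) * ‖y‖ := fun y => by
    refine le_of_sq_le_sq ?_ (by positivity)
    have h2 : ‖ContinuousLinearMap.adjoint (n ⟨m, hm⟩) (G y)‖ ^ 2 ≤
        ∑ k, ‖ContinuousLinearMap.adjoint (n k) (G y)‖ ^ 2 :=
      Finset.single_le_sum (f := fun k => ‖ContinuousLinearMap.adjoint (n k) (G y)‖ ^ 2)
        (fun k _ => sq_nonneg _) (Finset.mem_univ _)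
    refine h2.trans ?_
    have h3 := congrArg norm (sum_norm_adjoint_sq n (G y))
    rw [Complex.norm_real, Real.norm_of_nonneg (by positivity)] at h3
    rw [h3, ← ha]
    have h4 : ⟪G y, a (G y)⟫_ℂ = ⟪y, aeval a (X * g ^ 2) y⟫_ℂ := by
      have e1 : aeval a (X * g ^ 2) = G * (a * G) := by
        rw [show X * g ^ 2 = g * (X * g) by ring, map_mul, map_mul, aeval_X]
      rw [e1, mul_apply_eq_comp, mul_apply_eq_comp]
      nth_rewrite 1 [← hGsa]
      rw [ContinuousLinearMap.adjoint_inner_left]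
    rw [h4]
    calc _ ≤ ‖y‖ * ‖aeval a (X * g ^ 2) y‖ := norm_inner_le_norm _ _
      _ ≤ ‖y‖ * ((r * δ) ^ 2 * ‖y‖) := by
        refine mul_le_mul_of_nonneg_left (ContinuousLinearMap.le_of_opNorm_le _ ?_ _) (norm_nonneg _)
        exact norm_aeval_le ha0 ha1 (by positivity) fun t ht => by simpa [hg] using (hp t ht).2
      _ = _ := by ring
  have h5 : ‖G ∘L n ⟨m, hm⟩‖ ≤ r * δ := by
    rw [← LinearIsometryEquiv.norm_map ContinuousLinearMap.adjoint (G ∘L n ⟨m, hm⟩),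
      ContinuousLinearMap.adjoint_comp, hGsa]
    exact ContinuousLinearMap.opNorm_le_bound _ (by positivity) h1
  have h6 : G ∘L n ⟨m, hm⟩ = (r : ℂ) • (G ∘L (m : H →L[ℂ] K)) := by
    ext x
    simp [n]
  rw [h6, norm_smul, Complex.norm_real, Real.norm_of_nonneg hr.le] at h5
  exact le_of_mul_le_mul_left h5 hr

theorem exists_finset_norm_le {y : K}
    (hy : y ∈ Submodule.span ℂ {y | ∃ m ∈ M, ∃ x : H, y = m x}) :
    ∃ (t : Finset M) (c : ℝ), 0 ≤ c ∧ ∀ (G : K →L[ℂ] K) (δ : ℝ), 0 ≤ δ →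
      (∀ m ∈ t, ‖G ∘L (m : H →L[ℂ] K)‖ ≤ δ) → ‖G y‖ ≤ c * δ := by
  classical
  induction hy using Submodule.span_induction with
  | mem y hy =>
    obtain ⟨m, hm, x, rfl⟩ := hy
    refine ⟨{⟨m, hm⟩}, ‖x‖, norm_nonneg _, fun G δ _ hG => ?_⟩
    rw [mul_comm]
    exact (G ∘L m).le_of_opNorm_le (hG ⟨m, hm⟩ (by simp)) x
  | zero => exact ⟨∅, 0, le_rfl, fun G δ _ _ => by simp⟩
  | add y z _ _ ihy ihz =>
    obtain ⟨t, c, hc, h⟩ := ihy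
    obtain ⟨t', c', hc', h'⟩ := ihz
    refine ⟨t ∪ t', c + c', by positivity, fun G δ hδ hG => ?_⟩
    rw [map_add, add_mul]
    exact (norm_add_le _ _).trans (add_le_add
      (h G δ hδ fun m hm => hG m (Finset.mem_union_left _ hm))
      (h' G δ hδ fun m hm => hG m (Finset.mem_union_right _ hm)))
  | smul a y _ ih =>
    obtain ⟨t, c, hc, h⟩ := ih
    refine ⟨t, ‖a‖ * c, by positivity, fun G δ hδ hG => ?_⟩
    rw [map_smul, norm_smul, mul_assoc]
    exact mul_le_mul_of_nonneg_left (h G δ hδ hG) (norm_nonneg _)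

/-- The filter of approximate units: it makes `∑ mₖ mₖ*` converge strongly to `1`. -/
def unitFilter (M : Submodule ℂ (H →L[ℂ] K)) : Filter (ColFamily M) :=
  Filter.comap (fun s (y : K) => s.unit y) (𝓝 id)

theorem tendsto_unit_apply (y : K) :
    Tendsto (fun s : ColFamily M => s.unit y) (unitFilter M) (𝓝 y) :=
  tendsto_pi_nhds.1 (tendsto_comap (f := fun (s : ColFamily M) (y : K) => s.unit y)) y

theorem unitFilter_neBot
    (hM : ∀ a ∈ M, ∀ b ∈ M, ∀ c ∈ M, a ∘L ContinuousLinearMap.adjoint b ∘L c ∈ M)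
    (hd : Dense (Submodule.span ℂ {y | ∃ m ∈ M, ∃ x : H, y = m x} : Set K)) :
    (unitFilter M).NeBot := by
  classical
  rw [unitFilter, comap_neBot_iff]
  intro v hv
  rw [nhds_pi, Filter.mem_pi] at hv
  obtain ⟨I, hI, w, hw, hwv⟩ := hv
  have h1 : ∀ y : K, ∃ ε > 0, Metric.ball y ε ⊆ w y := fun y => Metric.mem_nhds_iff.1 (hw y)
  choose ε hε hball using h1
  have h2 : ∀ y : K, ∃ z ∈ Submodule.span ℂ {y | ∃ m ∈ M, ∃ x : H, y = m x},
      ‖y - z‖ < ε y / 4 := fun y => by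
    obtain ⟨z, hz, hyz⟩ := Metric.dense_iff.1 hd y (ε y / 4) (by linarith [hε y])
    exact ⟨z, hyz, by rwa [Metric.mem_ball, dist_comm, dist_eq_norm] at hz⟩
  choose z hz hyz using h2
  choose t c hc ht using fun y => exists_finset_norm_le (hz y)
  let δ : K → ℝ := fun y => ε y / (4 * (c y + 1))
  have hδ : ∀ y, 0 < δ y := fun y => by
    have := hε y
    have := hc y
    positivity
  obtain ⟨δ₀, hδ₀, hle⟩ : ∃ δ₀ > 0, ∀ y ∈ hI.toFinset, δ₀ ≤ δ y := by
    rcases hI.toFinset.eq_empty_or_nonempty with h0 | h0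
    · exact ⟨1, one_pos, by simp [h0]⟩
    · exact ⟨hI.toFinset.inf' h0 δ, (Finset.lt_inf'_iff h0).2 fun y _ => hδ y,
        fun y hy => Finset.inf'_le _ hy⟩
  obtain ⟨s, hs⟩ := exists_colFamily_norm_le hM (hI.toFinset.biUnion t) hδ₀
  refine ⟨s, hwv fun y hy => hball y ?_⟩
  have hy' : y ∈ hI.toFinset := hI.mem_toFinset.2 hy
  have h3 : ‖(1 - s.unit) (z y)‖ ≤ c y * δ y := by
    refine ht y _ _ (hδ y).le fun m hm => ?_
    exact (hs m (Finset.mem_biUnion.2 ⟨y, hy', hm⟩)).trans (hle y hy')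
  have h4 : c y * δ y ≤ ε y / 4 := by
    have := hc y
    have := hε y
    simp only [δ]
    rw [mul_div_assoc', div_le_div_iff₀ (by positivity) (by positivity)]
    nlinarith
  have h5 : s.unit y - y = s.unit (y - z y) - (y - z y) - (1 - s.unit) (z y) := by
    simp only [map_sub, sub_apply, one_apply_eq_self]
    abel
  rw [Metric.mem_ball, dist_eq_norm]
  change ‖s.unit y - y‖ < _
  rw [h5]
  have h6 := norm_sub_le (s.unit (y - z y) - (y - z y)) ((1 - s.unit) (z y))
  have h7 := norm_sub_le (s.unit (y - z y)) (y - z y)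
  have h8 := s.norm_unit_apply_le (y - z y)
  have h9 := hyz y
  have := hε y
  linarith

/-- The approximate unit converges to `1` in the w*-topology. -/
theorem tendsto_unit_wstar :
    Tendsto (fun s : ColFamily M => s.unit) (unitFilter M) (@nhds _ (wstarTopology K K) 1) := by
  rw [nhds_induced, tendsto_comap_iff, tendsto_pi_nhds]
  intro p
  refine tendsto_tsum_of_dominated_convergence (bound := fun n => ‖p.1.1 n‖ ^ 2 + ‖p.1.2 n‖ ^ 2)
    (p.2.1.add p.2.2) (fun n => ?_) (Eventually.of_forall fun s n => ?_)
  · exact tendsto_const_nhds.inner (tendsto_unit_apply _)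
  · have h1 : ‖⟪p.1.2 n, s.unit (p.1.1 n)⟫_ℂ‖ ≤ ‖p.1.2 n‖ * ‖p.1.1 n‖ :=
      (norm_inner_le_norm _ _).trans
        (mul_le_mul_of_nonneg_left (s.norm_unit_apply_le _) (norm_nonneg _))
    nlinarith [sq_nonneg (‖p.1.1 n‖ - ‖p.1.2 n‖), sq_nonneg ‖p.1.1 n‖, sq_nonneg ‖p.1.2 n‖]

end ApproximateUnit

/-! ### Completely contractive maps on rectangular matrices -/

section Rectangular

theorem norm_opMatrix_sumElim_sq {A : Type*} [Zero A] {E : Type*} [NormedAddCommGroup E]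
    [NormedSpace ℂ E] {ι κ : Type*} [Fintype ι] [Fintype κ] {n : ℕ} (e : ι ⊕ κ ≃ Fin n)
    (Y : ι → κ → A) (φ : A → E →L[ℂ] E) (hφ : φ 0 = 0) (v : PiLp 2 fun _ : Fin n => E) :
    ‖opMatrix (Matrix.map (Matrix.of fun a b => Sum.elim (fun i => Sum.elim (fun _ => 0) (Y i))
      (fun _ _ => 0) (e.symm a) (e.symm b)) φ) v‖ ^ 2 =
      ∑ i, ‖∑ j, φ (Y i j) (v (e (Sum.inr j)))‖ ^ 2 := by
  rw [PiLp.norm_sq_eq_of_L2, ← e.sum_comp, Fintype.sum_sum_type]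
  simp only [opMatrix_apply, Matrix.map_apply, Matrix.of_apply, Equiv.symm_apply_apply]
  simp only [Sum.elim_inl, Sum.elim_inr, hφ, zero_apply, Finset.sum_const_zero, norm_zero,
    zero_pow two_ne_zero, add_zero]
  refine Finset.sum_congr rfl fun i _ => ?_
  rw [← e.sum_comp, Fintype.sum_sum_type]
  simp [hφ]

theorem NormalRep.sum_norm_sq_le {H₀ : Type u} [NormedAddCommGroup H₀] [InnerProductSpace ℂ H₀]
    [CompleteSpace H₀] {A : Subalgebra ℂ (H₀ →L[ℂ] H₀)} (X : NormalRep A) {ι κ : Type*}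
    [Fintype ι] [Fintype κ] (Y : ι → κ → A) {c : ℝ} (hc : 0 ≤ c)
    (hY : ∀ v : κ → H₀, ∑ i, ‖∑ j, (Y i j : H₀ →L[ℂ] H₀) (v j)‖ ^ 2 ≤ c ^ 2 * ∑ j, ‖v j‖ ^ 2)
    (w : κ → X.carrier) :
    ∑ i, ‖∑ j, X.rep (Y i j) (w j)‖ ^ 2 ≤ c ^ 2 * ∑ j, ‖w j‖ ^ 2 := by
  let e := Fintype.equivFin (ι ⊕ κ)
  let Z : Matrix (Fin (Fintype.card (ι ⊕ κ))) (Fin (Fintype.card (ι ⊕ κ))) A :=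
    Matrix.of fun a b => Sum.elim (fun i => Sum.elim (fun _ => 0) (Y i))
      (fun _ _ => 0) (e.symm a) (e.symm b)
  have h1 : ‖opMatrix (Z.map fun a => (a : H₀ →L[ℂ] H₀))‖ ≤ c := by
    refine ContinuousLinearMap.opNorm_le_bound _ hc fun v => ?_
    refine le_of_sq_le_sq ?_ (by positivity)
    rw [norm_opMatrix_sumElim_sq e Y (fun a => (a : H₀ →L[ℂ] H₀)) rfl v, mul_pow]
    refine (hY _).trans (mul_le_mul_of_nonneg_left ?_ (sq_nonneg c))
    rw [PiLp.norm_sq_eq_of_L2, ← e.sum_comp, Fintype.sum_sum_type]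
    exact le_add_of_nonneg_left (by positivity)
  have h2 := (opMatrix (Z.map fun a => X.rep a)).le_of_opNorm_le
    ((X.completelyContractive _ Z).trans h1)
    (WithLp.toLp 2 fun a => Sum.elim (fun _ => 0) w (e.symm a))
  have h3 := pow_le_pow_left₀ (norm_nonneg _) h2 2
  rw [norm_opMatrix_sumElim_sq e Y (fun a => X.rep a) (map_zero _), mul_pow,
    PiLp.norm_sq_eq_of_L2, ← e.sum_comp, Fintype.sum_sum_type] at h3
  simpa using h3

end Rectangular

section TRO

open Filter

variable {H₀ K₀ : Type u}
  [NormedAddCommGroup H₀] [InnerProductSpace ℂ H₀] [CompleteSpace H₀]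
  [NormedAddCommGroup K₀] [InnerProductSpace ℂ K₀] [CompleteSpace K₀]
  {A : Subalgebra ℂ (H₀ →L[ℂ] H₀)} {B : Subalgebra ℂ (K₀ →L[ℂ] K₀)}
  {M : Submodule ℂ (H₀ →L[ℂ] K₀)}

/-! ### Consequences of TRO equivalence -/

/-- `M* ⊆ V`. -/
theorem adjoint_mem_bimodV {m : H₀ →L[ℂ] K₀} (hm : m ∈ M) :
    ContinuousLinearMap.adjoint m ∈ bimodV B M :=
  subset_wstarSpan _ ⟨m, hm, 1, B.one_mem, rfl⟩

theorem IsTROEquivalence.mul_adjoint_mem (h : IsTROEquivalence A B M) {m n : H₀ →L[ℂ] K₀}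
    (hm : m ∈ M) (hn : n ∈ M) : m ∘L ContinuousLinearMap.adjoint n ∈ B := by
  rw [← Subalgebra.mem_toSubmodule, h.right_eq]
  exact subset_wstarSpan _ ⟨m, hm, 1, A.one_mem, n, hn, rfl⟩

theorem IsTROEquivalence.isClosed_right (h : IsTROEquivalence A B M) :
    IsClosed[wstarTopology K₀ K₀] (B : Set (K₀ →L[ℂ] K₀)) := by
  have : (B : Set (K₀ →L[ℂ] K₀)) = (Subalgebra.toSubmodule B : Submodule ℂ (K₀ →L[ℂ] K₀)) := rfl
  rw [this, h.right_eq]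
  exact isClosed_wstarSpan _

/-- `M H₀` spans a dense subspace of `K₀`. -/
theorem IsTROEquivalence.dense_span (h : IsTROEquivalence A B M) :
    Dense (Submodule.span ℂ {y | ∃ m ∈ M, ∃ x : H₀, y = m x} : Set K₀) := by
  rw [Submodule.dense_iff_topologicalClosure_eq_top, Submodule.topologicalClosure_eq_top_iff,
    Submodule.eq_bot_iff]
  intro y hy
  let p : Submodule ℂ (K₀ →L[ℂ] K₀) := LinearMap.ker (vecFunctional y y).toLinearMap
  have hp : IsClosed[wstarTopology K₀ K₀] (p : Set (K₀ →L[ℂ] K₀)) := by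
    let : TopologicalSpace (K₀ →L[ℂ] K₀) := wstarTopology K₀ K₀
    exact isClosed_singleton.preimage (wstar_continuous_inner y y)
  have h1 : (1 : K₀ →L[ℂ] K₀) ∈ wstarSpan
      {T | ∃ m ∈ M, ∃ a ∈ A, ∃ n ∈ M, T = m ∘L a ∘L ContinuousLinearMap.adjoint n} := by
    rw [← h.right_eq]
    exact B.one_mem
  have h2 := map_mem_of_mem_wstarSpan hp LinearMap.id
    (@continuous_id _ (wstarTopology K₀ K₀)) (fun T hT => ?_) h1
  · have h3 : ⟪y, y⟫_ℂ = 0 := h2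
    exact inner_self_eq_zero.1 h3
  · obtain ⟨m, hm, a, -, n, -, rfl⟩ := hT
    change ⟪y, m (a (ContinuousLinearMap.adjoint n y))⟫_ℂ = 0
    have h3 : m (a (ContinuousLinearMap.adjoint n y)) ∈
        Submodule.span ℂ {y | ∃ m ∈ M, ∃ x : H₀, y = m x} :=
      Submodule.subset_span ⟨m, hm, _, rfl⟩
    exact Submodule.inner_left_of_mem_orthogonal h3 hy

theorem IsTROEquivalence.unitFilter_neBot (h : IsTROEquivalence A B M) : (unitFilter M).NeBot :=
  DualOpAlg.unitFilter_neBot h.isTRO h.dense_span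

/-- The operator `∑ mₖ mₖ*` as an element of `B`. -/
def ColFamily.unitB (h : IsTROEquivalence A B M) (s : ColFamily M) : B :=
  ⟨s.unit, Subalgebra.sum_mem B (t := Finset.univ)
    (f := fun k => s.op k ∘L ContinuousLinearMap.adjoint (s.op k))
    fun k _ => h.mul_adjoint_mem (s.op_mem k) (s.op_mem k)⟩

/-- The entries of the column of a family, as elements of `V`. -/
def ColFamily.col (B : Subalgebra ℂ (K₀ →L[ℂ] K₀)) (s : ColFamily M) (k : Fin s.1) : bimodV B M :=
  ⟨ContinuousLinearMap.adjoint (s.op k), adjoint_mem_bimodV (s.op_mem k)⟩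

theorem tendsto_unitB (h : IsTROEquivalence A B M) :
    Tendsto (ColFamily.unitB h) (unitFilter M)
      (@nhds _ (TopologicalSpace.induced Subtype.val (wstarTopology K₀ K₀)) (1 : B)) := by
  let : TopologicalSpace (K₀ →L[ℂ] K₀) := wstarTopology K₀ K₀
  rw [nhds_induced, tendsto_comap_iff]
  exact tendsto_unit_wstar

/-- The matrix coefficients `b ↦ ⟨y, α(S b T) x⟩` are w*-continuous. -/
theorem continuous_coeff (h : IsTROEquivalence A B M) (X : NormalRep A) (S : bimodV B M)
    (T : bimodU B M) (x y : X.carrier) :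
    Continuous[TopologicalSpace.induced Subtype.val (wstarTopology K₀ K₀), inferInstance]
      fun b : B => ⟪y, X.rep ⟨(S : K₀ →L[ℂ] H₀) ∘L (mulU b T : H₀ →L[ℂ] K₀),
        h.comp_mem S.2 (mulU b T).2⟩ x⟫_ℂ := by
  let : TopologicalSpace (K₀ →L[ℂ] K₀) := wstarTopology K₀ K₀
  let : TopologicalSpace (H₀ →L[ℂ] K₀) := wstarTopology H₀ K₀
  let : TopologicalSpace (H₀ →L[ℂ] H₀) := wstarTopology H₀ H₀
  let : TopologicalSpace (X.carrier →L[ℂ] X.carrier) := wstarTopology X.carrier X.carrier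
  let : TopologicalSpace A := TopologicalSpace.induced Subtype.val (wstarTopology H₀ H₀)
  let : TopologicalSpace B := TopologicalSpace.induced Subtype.val (wstarTopology K₀ K₀)
  have h1 : Continuous fun b : B => (b : K₀ →L[ℂ] K₀) := continuous_induced_dom
  have h2 : Continuous fun b : B => (b : K₀ →L[ℂ] K₀) ∘L (T : H₀ →L[ℂ] K₀) :=
    (wstar_continuous_comp_right (T : H₀ →L[ℂ] K₀)).comp h1
  have h3 : Continuous fun b : B =>
      (S : K₀ →L[ℂ] H₀) ∘L ((b : K₀ →L[ℂ] K₀) ∘L (T : H₀ →L[ℂ] K₀)) :=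
    (wstar_continuous_comp_left (S : K₀ →L[ℂ] H₀)).comp h2
  have h4 : Continuous fun b : B => (⟨(S : K₀ →L[ℂ] H₀) ∘L (mulU b T : H₀ →L[ℂ] K₀),
      h.comp_mem S.2 (mulU b T).2⟩ : A) := continuous_induced_rng.2 h3
  exact (wstar_continuous_inner x y).comp (X.wstarContinuous.comp h4)

/-! ### Evaluation of `F_U(H)` at elements of `V` -/

theorem FUSpace.dense_span_tmul (h : IsTROEquivalence A B M) (X : NormalRep A) (z : PreFU h X) :
    (z : FUSpace h X) ∈ Submodule.span ℂ (Set.range fun p : bimodU B M × X.carrier =>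
      FUSpace.tmul h X p.1 p.2) := by
  change (bimodU B M) ⊗[ℂ] X.carrier at z
  let ι : (bimodU B M) ⊗[ℂ] X.carrier →ₗ[ℂ] FUSpace h X :=
    (UniformSpace.Completion.toComplL (𝕜 := ℂ) (E := PreFU h X)).toLinearMap
  change ι z ∈ _
  induction z using TensorProduct.induction_on with
  | zero => rw [map_zero]; exact Submodule.zero_mem _
  | tmul T x => exact Submodule.subset_span ⟨(T, x), rfl⟩
  | add z w hz hw => rw [map_add]; exact Submodule.add_mem _ hz hw

/-- The operator `F_U(H) → H`, `T ⊗ x ↦ α(S T) x`, for `S ∈ V`. -/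
def evalV (h : IsTROEquivalence A B M) (X : NormalRep A) (S : bimodV B M) :
    FUSpace h X →L[ℂ] X.carrier :=
  LinearMap.extendOfNorm (E := PreFU h X)
    (show (bimodU B M) ⊗[ℂ] X.carrier →ₗ[ℂ] X.carrier from
      PiLp.projₗ (𝕜 := ℂ) 2 (fun _ : Fin 1 => X.carrier) 0 ∘ₗ colEval h X fun _ : Fin 1 => S)
    (UniformSpace.Completion.toComplL (𝕜 := ℂ) (E := PreFU h X)).toLinearMap

theorem evalV_tmul (h : IsTROEquivalence A B M) (X : NormalRep A) (S : bimodV B M)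
    (T : bimodU B M) (x : X.carrier) :
    evalV h X S (FUSpace.tmul h X T x) =
      X.rep ⟨(S : K₀ →L[ℂ] H₀) ∘L (T : H₀ →L[ℂ] K₀), h.comp_mem S.2 T.2⟩ x := by
  have h1 := LinearMap.extendOfNorm_eq (E := PreFU h X)
    (f := (show (bimodU B M) ⊗[ℂ] X.carrier →ₗ[ℂ] X.carrier from
      PiLp.projₗ (𝕜 := ℂ) 2 (fun _ : Fin 1 => X.carrier) 0 ∘ₗ colEval h X fun _ : Fin 1 => S))
    (e := (UniformSpace.Completion.toComplL (𝕜 := ℂ) (E := PreFU h X)).toLinearMap)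
    UniformSpace.Completion.denseRange_coe
    ⟨‖colOp fun _ : Fin 1 => (S : K₀ →L[ℂ] H₀)‖, fun z => by
      change ‖colEval h X (fun _ : Fin 1 => S) z 0‖ ≤ _ * ‖(z : FUSpace h X)‖
      rw [UniformSpace.Completion.norm_coe]
      exact (PiLp.norm_apply_le _ _).trans (colEval_le h X (fun _ : Fin 1 => S) z)⟩
    (T ⊗ₜ[ℂ] x)
  exact h1.trans (colEval_tmul h X (fun _ : Fin 1 => S) T x 0)

theorem evalV_coe (h : IsTROEquivalence A B M) (X : NormalRep A) {n : ℕ} (S : Fin n → bimodV B M)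
    (i : Fin n) (z : PreFU h X) : evalV h X (S i) (z : FUSpace h X) = colEval h X S z i := by
  change (bimodU B M) ⊗[ℂ] X.carrier at z
  let ι : (bimodU B M) ⊗[ℂ] X.carrier →ₗ[ℂ] FUSpace h X :=
    (UniformSpace.Completion.toComplL (𝕜 := ℂ) (E := PreFU h X)).toLinearMap
  have : (evalV h X (S i)).toLinearMap ∘ₗ ι =
      PiLp.projₗ (𝕜 := ℂ) 2 (fun _ : Fin n => X.carrier) i ∘ₗ colEval h X S :=
    TensorProduct.ext' fun T x =>
      (evalV_tmul h X (S i) T x).trans (colEval_tmul h X S T x i).symm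
  exact LinearMap.congr_fun this z

theorem sum_norm_evalV_sq_le (h : IsTROEquivalence A B M) (X : NormalRep A) {n : ℕ}
    (S : Fin n → bimodV B M) (hS : ‖colOp fun i => (S i : K₀ →L[ℂ] H₀)‖ ≤ 1)
    (z : FUSpace h X) : ∑ i, ‖evalV h X (S i) z‖ ^ 2 ≤ ‖z‖ ^ 2 := by
  induction z using UniformSpace.Completion.induction_on with
  | hp => exact isClosed_le (by fun_prop) (by fun_prop)
  | ih z =>
    simp only [evalV_coe]
    rw [← PiLp.norm_sq_eq_of_L2, UniformSpace.Completion.norm_coe]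
    exact pow_le_pow_left₀ (norm_nonneg _) (le_supNorm h X ⟨n, S, hS⟩ z) 2

theorem evalV_actCLM (h : IsTROEquivalence A B M) (X : NormalRep A) (S : bimodV B M) (b : B)
    (z : FUSpace h X) : evalV h X S (actCLM h X b z) =
      evalV h X ⟨(S : K₀ →L[ℂ] H₀) ∘L (b : K₀ →L[ℂ] K₀), comp_mem_bimodV b.2 S.2⟩ z := by
  have : evalV h X S ∘L actCLM h X b =
      evalV h X ⟨(S : K₀ →L[ℂ] H₀) ∘L (b : K₀ →L[ℂ] K₀), comp_mem_bimodV b.2 S.2⟩ :=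
    FUSpace.hom_ext fun T x => by
      rw [ContinuousLinearMap.comp_apply, actCLM_tmul, evalV_tmul, evalV_tmul]
      rfl
  exact DFunLike.congr_fun this z

theorem norm_colOp_le_one {n : ℕ} {S : Fin n → K₀ →L[ℂ] H₀}
    (hS : ∀ y, ∑ k, ‖S k y‖ ^ 2 ≤ ‖y‖ ^ 2) : ‖colOp S‖ ≤ 1 := by
  refine ContinuousLinearMap.opNorm_le_bound _ zero_le_one fun v => ?_
  refine le_of_sq_le_sq ?_ (by positivity)
  rw [PiLp.norm_sq_eq_of_L2, one_mul, PiLp.norm_sq_eq_of_L2]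
  simpa [colOp, opMatrix_apply] using hS (v 0)

/-- The components `T ⊗ x ↦ α(mₖ* T) x` of the column of a family. -/
def colComp (h : IsTROEquivalence A B M) (X : NormalRep A) (s : ColFamily M) (k : Fin s.1) :
    FUSpace h X →L[ℂ] X.carrier :=
  evalV h X (s.col B k)

theorem sum_norm_colComp_sq_le (h : IsTROEquivalence A B M) (X : NormalRep A) (s : ColFamily M)
    (z : FUSpace h X) : ∑ k, ‖colComp h X s k z‖ ^ 2 ≤ ‖z‖ ^ 2 :=
  sum_norm_evalV_sq_le h X (s.col B) (norm_colOp_le_one s.sum_adjoint_le) z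

theorem evalV_actCLM_unitB (h : IsTROEquivalence A B M) (X : NormalRep A) (S : bimodV B M)
    (s : ColFamily M) (z : FUSpace h X) : evalV h X S (actCLM h X (s.unitB h) z) =
      ∑ k, X.rep ⟨(S : K₀ →L[ℂ] H₀) ∘L s.op k, h.comp_mem S.2 (mem_bimodU (s.op_mem k))⟩
        (colComp h X s k z) := by
  have : evalV h X S ∘L actCLM h X (s.unitB h) =
      ∑ k, X.rep ⟨(S : K₀ →L[ℂ] H₀) ∘L s.op k, h.comp_mem S.2 (mem_bimodU (s.op_mem k))⟩ ∘L
        colComp h X s k :=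
    FUSpace.hom_ext fun T x => by
      rw [ContinuousLinearMap.comp_apply, actCLM_tmul, evalV_tmul]
      simp only [sum_apply, ContinuousLinearMap.comp_apply, colComp, evalV_tmul]
      have e : (⟨(S : K₀ →L[ℂ] H₀) ∘L (mulU (s.unitB h) T : H₀ →L[ℂ] K₀),
          h.comp_mem S.2 (mulU (s.unitB h) T).2⟩ : A) =
          ∑ k, ⟨(S : K₀ →L[ℂ] H₀) ∘L s.op k, h.comp_mem S.2 (mem_bimodU (s.op_mem k))⟩ *
            ⟨(s.col B k : K₀ →L[ℂ] H₀) ∘L (T : H₀ →L[ℂ] K₀), h.comp_mem (s.col B k).2 T.2⟩ := by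
        ext v
        have e1 : (mulU (s.unitB h) T : H₀ →L[ℂ] K₀) v = s.unit ((T : H₀ →L[ℂ] K₀) v) := rfl
        simp only [AddSubmonoidClass.coe_finsetSum, sum_apply, ContinuousLinearMap.comp_apply, e1,
          s.unit_apply, map_sum]
        rfl
      rw [e, map_sum, sum_apply]
      simp only [map_mul, mul_apply_eq_comp]
  have h2 := DFunLike.congr_fun this z
  simpa using h2

theorem tendsto_inner_evalV_unit (h : IsTROEquivalence A B M) (X : NormalRep A) (S : bimodV B M)
    (y : X.carrier) {z : FUSpace h X}
    (hz : z ∈ Submodule.span ℂ (Set.range fun p : bimodU B M × X.carrier =>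
      FUSpace.tmul h X p.1 p.2)) :
    Tendsto (fun s : ColFamily M => ⟪y, evalV h X S (actCLM h X (s.unitB h) z)⟫_ℂ) (unitFilter M)
      (𝓝 ⟪y, evalV h X S z⟫_ℂ) := by
  induction hz using Submodule.span_induction with
  | mem z hz =>
    obtain ⟨⟨T, x⟩, rfl⟩ := hz
    simp only [actCLM_tmul, evalV_tmul]
    let : TopologicalSpace B := TopologicalSpace.induced Subtype.val (wstarTopology K₀ K₀)
    exact ((continuous_coeff h X S T x y).tendsto 1).comp (tendsto_unitB h)
  | zero => simpa using tendsto_const_nhds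
  | add z w _ _ hz hw => simpa only [map_add, inner_add_right] using hz.add hw
  | smul a z _ hz => simpa only [map_smul, inner_smul_right] using hz.const_mul a

/-- The column `T ⊗ x ↦ (α(mₖ* T) x)ₖ` of a family. -/
def colMap (h : IsTROEquivalence A B M) (X : NormalRep A) (s : ColFamily M) :
    FUSpace h X →ₗ[ℂ] PiLp 2 (fun _ : Fin s.1 => X.carrier) where
  toFun z := WithLp.toLp 2 fun k => colComp h X s k z
  map_add' z w := by ext k; simp
  map_smul' a z := by ext k; simp

theorem norm_colMap_sq (h : IsTROEquivalence A B M) (X : NormalRep A) (s : ColFamily M)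
    (z : FUSpace h X) : ‖colMap h X s z‖ ^ 2 = ∑ k, ‖colComp h X s k z‖ ^ 2 :=
  PiLp.norm_sq_eq_of_L2 _ _

theorem norm_colMap_le (h : IsTROEquivalence A B M) (X : NormalRep A) (s : ColFamily M)
    (z : FUSpace h X) : ‖colMap h X s z‖ ≤ ‖z‖ := by
  refine le_of_sq_le_sq ?_ (norm_nonneg _)
  rw [norm_colMap_sq]
  exact sum_norm_colComp_sq_le h X s z

theorem sum_norm_evalV_unit_sq_le (h : IsTROEquivalence A B M) (X : NormalRep A) {n : ℕ}
    (S : Fin n → bimodV B M) (hS : ‖colOp fun i => (S i : K₀ →L[ℂ] H₀)‖ ≤ 1) (s : ColFamily M)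
    (z : FUSpace h X) :
    ∑ i, ‖evalV h X (S i) (actCLM h X (s.unitB h) z)‖ ^ 2 ≤ ‖colMap h X s z‖ ^ 2 := by
  simp only [evalV_actCLM_unitB, norm_colMap_sq]
  rw [← one_mul (∑ k, ‖colComp h X s k z‖ ^ 2), ← one_pow 2]
  refine X.sum_norm_sq_le (fun i k => ⟨(S i : K₀ →L[ℂ] H₀) ∘L s.op k, _⟩) zero_le_one
    (fun v => ?_) _
  have e : ∀ i, ∑ k, ((S i : K₀ →L[ℂ] H₀) ∘L s.op k) (v k)
      = (S i : K₀ →L[ℂ] H₀) (∑ k, s.op k (v k)) := fun i => by simp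
  simp only [e]
  have h1 := norm_colOp_apply (fun i => (S i : K₀ →L[ℂ] H₀)) (∑ k, s.op k (v k))
  have h2 := pow_le_pow_left₀ (norm_nonneg _) h1 2
  rw [PiLp.norm_sq_eq_of_L2, mul_pow] at h2
  refine h2.trans (mul_le_mul
    (pow_le_pow_left₀ (ContinuousLinearMap.opNorm_nonneg _) hS 2) ?_ (sq_nonneg _) (by simp))
  exact norm_sum_apply_sq_le s.sum_adjoint_le v

theorem eventually_norm_colEval_le (h : IsTROEquivalence A B M) (X : NormalRep A) {n : ℕ}
    (S : Fin n → bimodV B M) (hS : ‖colOp fun i => (S i : K₀ →L[ℂ] H₀)‖ ≤ 1) (z : PreFU h X)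
    {ε : ℝ} (hε : 0 < ε) :
    ∀ᶠ s in unitFilter M, ‖colEval h X S z‖ - ε ≤ ‖colMap h X s (z : FUSpace h X)‖ := by
  set v := colEval h X S z with hv
  rcases (norm_nonneg v).eq_or_lt with h0 | h0
  · exact Eventually.of_forall fun s => by
      have := norm_nonneg (colMap h X s (z : FUSpace h X))
      linarith
  let w : ColFamily M → PiLp 2 (fun _ : Fin n => X.carrier) := fun s =>
    WithLp.toLp 2 fun i => evalV h X (S i) (actCLM h X (s.unitB h) (z : FUSpace h X))
  have hw : ∀ s, ‖w s‖ ≤ ‖colMap h X s (z : FUSpace h X)‖ := fun s => by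
    refine le_of_sq_le_sq ?_ (norm_nonneg _)
    rw [PiLp.norm_sq_eq_of_L2]
    exact sum_norm_evalV_unit_sq_le h X S hS s _
  have ht : Tendsto (fun s => ⟪v, w s⟫_ℂ) (unitFilter M) (𝓝 ⟪v, v⟫_ℂ) := by
    simp only [PiLp.inner_apply]
    refine tendsto_finsetSum _ fun i _ => ?_
    have := tendsto_inner_evalV_unit h X (S i) (v i) (FUSpace.dense_span_tmul h X z)
    rwa [evalV_coe] at this
  have ht2 := ht.norm
  have e : ‖⟪v, v⟫_ℂ‖ = ‖v‖ * ‖v‖ := by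
    rw [inner_self_eq_norm_sq_to_K, norm_pow, sq]
    simp
  rw [e] at ht2
  filter_upwards [ht2.eventually (lt_mem_nhds (show ‖v‖ * ‖v‖ - ε * ‖v‖ < ‖v‖ * ‖v‖ by nlinarith))]
    with s hs
  have h1 : ‖v‖ * (‖v‖ - ε) ≤ ‖v‖ * ‖colMap h X s (z : FUSpace h X)‖ := by
    calc ‖v‖ * (‖v‖ - ε) = ‖v‖ * ‖v‖ - ε * ‖v‖ := by ring
      _ ≤ ‖⟪v, w s⟫_ℂ‖ := hs.le
      _ ≤ ‖v‖ * ‖w s‖ := norm_inner_le_norm _ _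
      _ ≤ _ := mul_le_mul_of_nonneg_left (hw s) h0.le
  exact le_of_mul_le_mul_left h1 h0

/-- The norm of `F_U(H)` is the limit of the Hilbert space seminorms of the columns in `M*`. -/
theorem tendsto_norm_colMap (h : IsTROEquivalence A B M) (X : NormalRep A) (z : FUSpace h X) :
    Tendsto (fun s : ColFamily M => ‖colMap h X s z‖) (unitFilter M) (𝓝 ‖z‖) := by
  refine Metric.tendsto_nhds.2 fun ε hε => ?_
  obtain ⟨w, hw⟩ : ∃ w : PreFU h X, ‖z - (w : FUSpace h X)‖ < ε / 4 := by
    obtain ⟨w, hw⟩ := UniformSpace.Completion.denseRange_coe.exists_dist_lt z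
      (show 0 < ε / 4 by linarith)
    exact ⟨w, by rwa [dist_eq_norm] at hw⟩
  obtain ⟨S, hS⟩ : ∃ S : ColBall B M, supNorm h X w - ε / 4 < ‖colEval h X S.2.1 w‖ :=
    exists_lt_of_lt_ciSup (sub_lt_self _ (by linarith))
  have hwn : ‖(w : FUSpace h X)‖ = supNorm h X w := UniformSpace.Completion.norm_coe w
  filter_upwards [eventually_norm_colEval_le h X S.2.1 S.2.2 w (show 0 < ε / 4 by linarith)]
    with s hs
  have h1 := norm_colMap_le h X s z
  have h2 := norm_colMap_le h X s (z - w)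
  rw [map_sub] at h2
  have h3 := norm_sub_norm_le (colMap h X s w) (colMap h X s z)
  rw [norm_sub_rev] at h3
  have h4 := norm_sub_norm_le z (w : FUSpace h X)
  rw [Real.dist_eq, abs_sub_lt_iff]
  constructor <;> linarith

/-! ### The Hilbert space structure of `F_U(H)` -/

instance FUSpace.innerProductSpaceable (h : IsTROEquivalence A B M) (X : NormalRep A) :
    InnerProductSpaceable (FUSpace h X) where
  parallelogram_identity z w := by
    have := h.unitFilter_neBot
    have t := tendsto_norm_colMap h X
    refine tendsto_nhds_unique (((t (z + w)).mul (t (z + w))).add ((t (z - w)).mul (t (z - w)))) ?_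
    refine ((((t z).mul (t z)).add ((t w).mul (t w))).const_mul 2).congr fun s => ?_
    rw [map_add, map_sub]
    exact (parallelogram_law_with_norm_mul ℂ _ _).symm

instance FUSpace.innerProductSpace (h : IsTROEquivalence A B M) (X : NormalRep A) :
    InnerProductSpace ℂ (FUSpace h X) :=
  InnerProductSpace.ofNorm ℂ (FUSpace.innerProductSpaceable h X).parallelogram_identity

theorem tendsto_inner_colMap (h : IsTROEquivalence A B M) (X : NormalRep A) (z w : FUSpace h X) :
    Tendsto (fun s : ColFamily M => ⟪colMap h X s z, colMap h X s w⟫_ℂ) (unitFilter M)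
      (𝓝 ⟪z, w⟫_ℂ) := by
  have t : ∀ z, Tendsto (fun s : ColFamily M => (‖colMap h X s z‖ : ℂ) ^ 2) (unitFilter M)
      (𝓝 ((‖z‖ : ℂ) ^ 2)) := fun z =>
    ((Complex.continuous_ofReal.tendsto _).comp (tendsto_norm_colMap h X z)).pow 2
  rw [inner_eq_sum_norm_sq_div_four]
  refine ((((t (z + w)).sub (t (z - w))).add (((t (z - Complex.I • w)).sub
    (t (z + Complex.I • w))).mul_const Complex.I)).div_const 4).congr fun s => ?_
  rw [inner_eq_sum_norm_sq_div_four]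
  simp only [map_add, map_sub, map_smul]
  rfl

theorem inner_colMap_tmul_left (h : IsTROEquivalence A B M) (X : NormalRep A) (s : ColFamily M)
    {m : H₀ →L[ℂ] K₀} (hm : m ∈ M) (x : X.carrier) (z : FUSpace h X) :
    ⟪colMap h X s (FUSpace.tmul h X ⟨m, mem_bimodU hm⟩ x), colMap h X s z⟫_ℂ =
      ⟪x, evalV h X ⟨ContinuousLinearMap.adjoint m, adjoint_mem_bimodV hm⟩
        (actCLM h X (s.unitB h) z)⟫_ℂ := by
  rw [evalV_actCLM_unitB, PiLp.inner_apply, inner_sum]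
  refine Finset.sum_congr rfl fun k _ => ?_
  change ⟪colComp h X s k (FUSpace.tmul h X ⟨m, mem_bimodU hm⟩ x), colComp h X s k _⟫_ℂ = _
  have e1 : colComp h X s k (FUSpace.tmul h X ⟨m, mem_bimodU hm⟩ x) =
      X.rep ⟨ContinuousLinearMap.adjoint (s.op k) ∘L m,
        h.comp_mem (adjoint_mem_bimodV (s.op_mem k)) (mem_bimodU hm)⟩ x := evalV_tmul _ _ _ _ _
  rw [e1]
  have hst : star (ContinuousLinearMap.adjoint (s.op k) ∘L m) =
      ContinuousLinearMap.adjoint m ∘L s.op k := by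
    rw [ContinuousLinearMap.star_eq_adjoint, ContinuousLinearMap.adjoint_comp,
      ContinuousLinearMap.adjoint_adjoint]
  have hmem : star (ContinuousLinearMap.adjoint (s.op k) ∘L m) ∈ A := by
    rw [hst]
    exact h.comp_mem (adjoint_mem_bimodV hm) (mem_bimodU (s.op_mem k))
  have e2 := X.rep_star ⟨ContinuousLinearMap.adjoint (s.op k) ∘L m,
    h.comp_mem (adjoint_mem_bimodV (s.op_mem k)) (mem_bimodU hm)⟩ hmem
  rw [← ContinuousLinearMap.adjoint_inner_right, ← ContinuousLinearMap.star_eq_adjoint, ← e2]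
  simp only [hst]

/-- `⟨m ⊗ x, z⟩ = ⟨x, α(m* z)⟩`. -/
theorem inner_tmul_left (h : IsTROEquivalence A B M) (X : NormalRep A) {m : H₀ →L[ℂ] K₀}
    (hm : m ∈ M) (x : X.carrier) (z : FUSpace h X) :
    ⟪FUSpace.tmul h X ⟨m, mem_bimodU hm⟩ x, z⟫_ℂ =
      ⟪x, evalV h X ⟨ContinuousLinearMap.adjoint m, adjoint_mem_bimodV hm⟩ z⟫_ℂ := by
  have := h.unitFilter_neBot
  suffices hs : innerSL ℂ (FUSpace.tmul h X ⟨m, mem_bimodU hm⟩ x) =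
      innerSL ℂ x ∘L evalV h X ⟨ContinuousLinearMap.adjoint m, adjoint_mem_bimodV hm⟩ from
    DFunLike.congr_fun hs z
  refine FUSpace.hom_ext fun T y => ?_
  change ⟪FUSpace.tmul h X ⟨m, mem_bimodU hm⟩ x, FUSpace.tmul h X T y⟫_ℂ = ⟪x, evalV h X _ _⟫_ℂ
  refine tendsto_nhds_unique (tendsto_inner_colMap h X _ _) ?_
  exact (tendsto_inner_evalV_unit h X ⟨ContinuousLinearMap.adjoint m, adjoint_mem_bimodV hm⟩ x
    (Submodule.subset_span ⟨(T, y), rfl⟩)).congr fun s =>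
      (inner_colMap_tmul_left h X s hm x _).symm

/-- `M ⊗ H` spans a dense subspace of `F_U(H)`. -/
theorem FUSpace.dense_span_tmul_mem (h : IsTROEquivalence A B M) (X : NormalRep A) :
    (Submodule.span ℂ (Set.range fun p : M × X.carrier =>
      FUSpace.tmul h X ⟨p.1, mem_bimodU p.1.2⟩ p.2)).topologicalClosure = ⊤ := by
  have := h.unitFilter_neBot
  rw [Submodule.topologicalClosure_eq_top_iff, Submodule.eq_bot_iff]
  intro z hz
  have h1 : ∀ m (hm : m ∈ M),
      evalV h X ⟨ContinuousLinearMap.adjoint m, adjoint_mem_bimodV hm⟩ z = 0 := fun m hm => by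
    refine ext_inner_left ℂ fun x => ?_
    rw [← inner_tmul_left h X hm, inner_zero_right]
    have hmem : FUSpace.tmul h X ⟨m, mem_bimodU hm⟩ x ∈
        Submodule.span ℂ (Set.range fun p : M × X.carrier =>
          FUSpace.tmul h X ⟨p.1, mem_bimodU p.1.2⟩ p.2) :=
      Submodule.subset_span ⟨(⟨m, hm⟩, x), rfl⟩
    exact Submodule.inner_right_of_mem_orthogonal hmem hz
  have h2 : ∀ s, ‖colMap h X s z‖ = 0 := fun s => by
    rw [norm_eq_zero]
    ext k
    exact h1 _ (s.op_mem k)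
  have h3 := tendsto_norm_colMap h X z
  simp only [h2] at h3
  exact norm_eq_zero.1 (tendsto_nhds_unique h3 tendsto_const_nhds)

theorem FUSpace.mem_of_tmul_mem {h : IsTROEquivalence A B M} {X : NormalRep A}
    {p : Submodule ℂ (FUSpace h X)} (hp : IsClosed (p : Set (FUSpace h X)))
    (hmem : ∀ (m : H₀ →L[ℂ] K₀) (hm : m ∈ M) (x : X.carrier),
      FUSpace.tmul h X ⟨m, mem_bimodU hm⟩ x ∈ p) (z : FUSpace h X) : z ∈ p := by
  have h1 : Submodule.span ℂ (Set.range fun p : M × X.carrier =>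
      FUSpace.tmul h X ⟨p.1, mem_bimodU p.1.2⟩ p.2) ≤ p := by
    rw [Submodule.span_le]
    rintro _ ⟨⟨m, x⟩, rfl⟩
    exact hmem m m.2 x
  have h2 := Submodule.topologicalClosure_minimal _ h1 hp
  rw [FUSpace.dense_span_tmul_mem] at h2
  exact h2 trivial

theorem FUSpace.hom_ext_mem {h : IsTROEquivalence A B M} {X : NormalRep A} {E : Type*}
    [NormedAddCommGroup E] [NormedSpace ℂ E] {f g : FUSpace h X →L[ℂ] E}
    (hfg : ∀ (m : H₀ →L[ℂ] K₀) (hm : m ∈ M) (x : X.carrier),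
      f (FUSpace.tmul h X ⟨m, mem_bimodU hm⟩ x) = g (FUSpace.tmul h X ⟨m, mem_bimodU hm⟩ x)) :
    f = g := by
  ext z
  exact FUSpace.mem_of_tmul_mem (p := LinearMap.eqLocus f.toLinearMap g.toLinearMap)
    (isClosed_eq f.continuous g.continuous) hfg z

end TRO

section TRO

open Filter

variable {H₀ K₀ : Type u}
  [NormedAddCommGroup H₀] [InnerProductSpace ℂ H₀] [CompleteSpace H₀]
  [NormedAddCommGroup K₀] [InnerProductSpace ℂ K₀] [CompleteSpace K₀]
  {A : Subalgebra ℂ (H₀ →L[ℂ] H₀)} {B : Subalgebra ℂ (K₀ →L[ℂ] K₀)}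
  {M : Submodule ℂ (H₀ →L[ℂ] K₀)}

/-! ### `β` is a normal representation -/

theorem norm_actCLM_apply_le (h : IsTROEquivalence A B M) (X : NormalRep A) (b : B)
    (z : FUSpace h X) : ‖actCLM h X b z‖ ≤ ‖(b : K₀ →L[ℂ] K₀)‖ * ‖z‖ := by
  induction z using UniformSpace.Completion.induction_on with
  | hp => exact isClosed_le (by fun_prop) (by fun_prop)
  | ih z =>
    have e : actCLM h X b (z : FUSpace h X) = (preAct h X b z : FUSpace h X) :=
      ContinuousLinearMap.completion_apply_coe _ _
    rw [e, UniformSpace.Completion.norm_coe, UniformSpace.Completion.norm_coe]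
    exact (preAct h X b).le_of_opNorm_le (LinearMap.mkContinuous_norm_le _ (norm_nonneg _) _) z

theorem inner_actCLM_unitB (h : IsTROEquivalence A B M) (X : NormalRep A) (s : ColFamily M)
    (z w : FUSpace h X) : ⟪actCLM h X (s.unitB h) z, w⟫_ℂ = ⟪colMap h X s z, colMap h X s w⟫_ℂ := by
  suffices hs : innerSL ℂ (actCLM h X (s.unitB h) z) =
      ∑ k, innerSL ℂ (colComp h X s k z) ∘L colComp h X s k by
    have h1 := DFunLike.congr_fun hs w
    rw [PiLp.inner_apply]
    simp only [innerSL_apply_apply, sum_apply, ContinuousLinearMap.comp_apply] at h1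
    exact h1
  refine FUSpace.hom_ext_mem fun m hm x => ?_
  have e : (∑ k, innerSL ℂ (colComp h X s k z) ∘L colComp h X s k)
      (FUSpace.tmul h X ⟨m, mem_bimodU hm⟩ x) =
      ⟪colMap h X s z, colMap h X s (FUSpace.tmul h X ⟨m, mem_bimodU hm⟩ x)⟫_ℂ := by
    rw [PiLp.inner_apply, sum_apply]
    rfl
  rw [e, innerSL_apply_apply, ← inner_conj_symm, ← inner_conj_symm (colMap h X s z),
    inner_colMap_tmul_left h X s hm, inner_tmul_left h X hm]

theorem tendsto_actCLM_unitB (h : IsTROEquivalence A B M) (X : NormalRep A) (z : FUSpace h X) :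
    Tendsto (fun s : ColFamily M => actCLM h X (s.unitB h) z) (unitFilter M) (𝓝 z) := by
  have h1 : ∀ s : ColFamily M, ‖actCLM h X (s.unitB h) z - z‖ ^ 2 ≤
      2 * (‖z‖ ^ 2 - ‖colMap h X s z‖ ^ 2) := fun s => by
    have e : RCLike.re ⟪actCLM h X (s.unitB h) z, z⟫_ℂ = ‖colMap h X s z‖ ^ 2 := by
      rw [inner_actCLM_unitB, inner_self_eq_norm_sq]
    have h2 : ‖actCLM h X (s.unitB h) z‖ ≤ ‖z‖ :=
      (norm_actCLM_apply_le h X _ z).trans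
        (mul_le_of_le_one_left (norm_nonneg _) s.norm_unit_le)
    have h3 := pow_le_pow_left₀ (norm_nonneg _) h2 2
    rw [@norm_sub_sq ℂ, e]
    linarith
  have h2 : Tendsto (fun s : ColFamily M => 2 * (‖z‖ ^ 2 - ‖colMap h X s z‖ ^ 2)) (unitFilter M)
      (𝓝 0) := by
    have := (((tendsto_norm_colMap h X z).pow 2).const_sub (‖z‖ ^ 2)).const_mul 2
    simpa using this
  have h3 := squeeze_zero (fun s => sq_nonneg _) h1 h2
  rw [tendsto_iff_norm_sub_tendsto_zero]
  have h4 := h3.sqrt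
  simpa using h4

theorem sum_norm_colComp_act_sq_le (h : IsTROEquivalence A B M) (X : NormalRep A) {n : ℕ}
    (b : Matrix (Fin n) (Fin n) B) (v : Fin n → FUSpace h X) (s t : ColFamily M) :
    ∑ i, ∑ l, ‖colComp h X s l (∑ j, actCLM h X (b i j) (actCLM h X (t.unitB h) (v j)))‖ ^ 2 ≤
      ‖opMatrix (b.map fun a => (a : K₀ →L[ℂ] K₀))‖ ^ 2 * ∑ j, ‖v j‖ ^ 2 := by
  set c := ‖opMatrix (b.map fun a => (a : K₀ →L[ℂ] K₀))‖ with hc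
  have hV : ∀ (i j : Fin n) (l : Fin s.1),
      ContinuousLinearMap.adjoint (s.op l) ∘L (b i j : K₀ →L[ℂ] K₀) ∈ bimodV B M := fun i j l =>
    comp_mem_bimodV (b i j).2 (adjoint_mem_bimodV (s.op_mem l))
  let Y : Fin n × Fin s.1 → Fin n × Fin t.1 → A := fun p q =>
    ⟨(ContinuousLinearMap.adjoint (s.op p.2) ∘L (b p.1 q.1 : K₀ →L[ℂ] K₀)) ∘L t.op q.2,
      h.comp_mem (hV p.1 q.1 p.2) (mem_bimodU (t.op_mem q.2))⟩
  have h1 : ∀ i l, colComp h X s l (∑ j, actCLM h X (b i j) (actCLM h X (t.unitB h) (v j))) =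
      ∑ q : Fin n × Fin t.1, X.rep (Y (i, l) q) (colComp h X t q.2 (v q.1)) := fun i l => by
    rw [map_sum, Fintype.sum_prod_type]
    refine Finset.sum_congr rfl fun j _ => ?_
    rw [colComp, evalV_actCLM, evalV_actCLM_unitB]
    rfl
  simp only [h1]
  rw [← Fintype.sum_prod_type (f := fun p : Fin n × Fin s.1 =>
    ‖∑ q : Fin n × Fin t.1, X.rep (Y p q) (colComp h X t q.2 (v q.1))‖ ^ 2)]
  refine (X.sum_norm_sq_le Y (c := c) (ContinuousLinearMap.opNorm_nonneg _) (fun u => ?_) _).trans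
    (mul_le_mul_of_nonneg_left ?_ (sq_nonneg c))
  · let y : Fin n → K₀ := fun j => ∑ k, t.op k (u (j, k))
    have h2 : ∀ p, ∑ q, (Y p q : H₀ →L[ℂ] H₀) (u q) = ContinuousLinearMap.adjoint (s.op p.2)
        (∑ j, (b p.1 j : K₀ →L[ℂ] K₀) (y j)) := fun p => by
      rw [Fintype.sum_prod_type, map_sum]
      refine Finset.sum_congr rfl fun j _ => ?_
      simp only [y, map_sum]
      rfl
    simp only [h2]
    rw [Fintype.sum_prod_type]
    calc _ ≤ ∑ i, ‖∑ j, (b i j : K₀ →L[ℂ] K₀) (y j)‖ ^ 2 :=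
          Finset.sum_le_sum fun i _ => s.sum_adjoint_le _
      _ ≤ c ^ 2 * ∑ j, ‖y j‖ ^ 2 := by
          have h3 := (opMatrix (b.map fun a => (a : K₀ →L[ℂ] K₀))).le_opNorm (WithLp.toLp 2 y)
          have h4 := pow_le_pow_left₀ (norm_nonneg _) h3 2
          rw [mul_pow, PiLp.norm_sq_eq_of_L2, PiLp.norm_sq_eq_of_L2] at h4
          simpa [opMatrix_apply] using h4
      _ ≤ c ^ 2 * ∑ q, ‖u q‖ ^ 2 := by
          refine mul_le_mul_of_nonneg_left ?_ (sq_nonneg c)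
          rw [Fintype.sum_prod_type]
          exact Finset.sum_le_sum fun j _ => norm_sum_apply_sq_le t.sum_adjoint_le _
  · rw [Fintype.sum_prod_type]
    exact Finset.sum_le_sum fun j _ => sum_norm_colComp_sq_le h X t (v j)

theorem actRep_completelyContractive (h : IsTROEquivalence A B M) (X : NormalRep A) :
    IsCompletelyContractive (actRep h X) := by
  have := h.unitFilter_neBot
  intro n b
  refine ContinuousLinearMap.opNorm_le_bound _ (ContinuousLinearMap.opNorm_nonneg _) fun v => ?_
  refine le_of_sq_le_sq ?_ (mul_nonneg (ContinuousLinearMap.opNorm_nonneg _) (norm_nonneg _))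
  rw [mul_pow, PiLp.norm_sq_eq_of_L2, PiLp.norm_sq_eq_of_L2]
  have h1 : ∀ s : ColFamily M, ∑ i, ∑ l, ‖colComp h X s l (∑ j, actCLM h X (b i j) (v j))‖ ^ 2 ≤
      ‖opMatrix (b.map fun a => (a : K₀ →L[ℂ] K₀))‖ ^ 2 * ∑ j, ‖v j‖ ^ 2 := fun s => by
    refine le_of_tendsto' (x := unitFilter M) (tendsto_finsetSum _ fun i _ => tendsto_finsetSum _ fun l _ => ?_)
      (sum_norm_colComp_act_sq_le h X b v s)
    refine Tendsto.pow (Tendsto.norm (((colComp h X s l).continuous.tendsto _).comp ?_)) 2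
    exact tendsto_finsetSum _ fun j _ => ((actCLM h X (b i j)).continuous.tendsto _).comp
      (tendsto_actCLM_unitB h X (v j))
  refine le_of_tendsto' (x := unitFilter M) (tendsto_finsetSum _ fun i _ => ?_) h1
  have h2 := (tendsto_norm_colMap h X (∑ j, actCLM h X (b i j) (v j))).pow 2
  simp only [norm_colMap_sq] at h2
  rw [opMatrix_apply]
  exact h2

/-- The algebra `B`, as a normed space. -/
def NormedAlg (B : Subalgebra ℂ (K₀ →L[ℂ] K₀)) : Type u := B

instance (B : Subalgebra ℂ (K₀ →L[ℂ] K₀)) : NormedAddCommGroup (NormedAlg B) :=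
  inferInstanceAs (NormedAddCommGroup B)

instance (B : Subalgebra ℂ (K₀ →L[ℂ] K₀)) : NormedSpace ℂ (NormedAlg B) :=
  inferInstanceAs (NormedSpace ℂ B)

/-- The inclusion of `B` into the bounded operators, as an isometry. -/
def valIsometry (B : Subalgebra ℂ (K₀ →L[ℂ] K₀)) : NormedAlg B →ₗᵢ[ℂ] (K₀ →L[ℂ] K₀) where
  toLinearMap := B.val.toLinearMap
  norm_map' _ := rfl

/-- The functional `b ↦ ⟨y, β(b) x⟩`. -/
def repFunctional (h : IsTROEquivalence A B M) (X : NormalRep A) (x y : FUSpace h X) :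
    NormedAlg B →L[ℂ] ℂ :=
  LinearMap.mkContinuous (E := NormedAlg B)
    ((vecFunctional x y).toLinearMap ∘ₗ (actRep h X).toLinearMap) (‖x‖ * ‖y‖) fun b => by
      change B at b
      change ‖⟪y, actCLM h X b x⟫_ℂ‖ ≤ ‖x‖ * ‖y‖ * ‖(b : K₀ →L[ℂ] K₀)‖
      calc _ ≤ ‖y‖ * ‖actCLM h X b x‖ := norm_inner_le_norm _ _
        _ ≤ ‖y‖ * (‖(b : K₀ →L[ℂ] K₀)‖ * ‖x‖) :=
          mul_le_mul_of_nonneg_left (norm_actCLM_apply_le h X b x) (norm_nonneg _)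
        _ = _ := by ring

theorem repFunctional_apply (h : IsTROEquivalence A B M) (X : NormalRep A) (x y : FUSpace h X)
    (b : NormedAlg B) : repFunctional h X x y b = ⟪y, actCLM h X b x⟫_ℂ := rfl

theorem norm_repFunctional_le (h : IsTROEquivalence A B M) (X : NormalRep A) (x y : FUSpace h X) :
    ‖repFunctional h X x y‖ ≤ ‖x‖ * ‖y‖ :=
  LinearMap.mkContinuous_norm_le _ (by positivity) _

/-- A bounded sesquilinear map on `F_U(H)` takes values in a closed subspace if it does so on
`M ⊗ H`. -/
theorem FUSpace.sesquilinear_mem {h : IsTROEquivalence A B M} {X : NormalRep A} {D : Type*}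
    [NormedAddCommGroup D] [NormedSpace ℂ D] {R : Submodule ℂ D} (hR : IsClosed (R : Set D))
    (f : FUSpace h X → FUSpace h X → D)
    (hadd : ∀ x x' y, f (x + x') y = f x y + f x' y)
    (hsmul : ∀ (a : ℂ) x y, f (a • x) y = a • f x y)
    (hadd' : ∀ x y y', f x (y + y') = f x y + f x y')
    (hsmul' : ∀ (a : ℂ) x y, f x (a • y) = starRingEnd ℂ a • f x y)
    (hf : ∀ x y, ‖f x y‖ ≤ ‖x‖ * ‖y‖)
    (hmem : ∀ (m : H₀ →L[ℂ] K₀) (hm : m ∈ M) (n : H₀ →L[ℂ] K₀) (hn : n ∈ M) (x y : X.carrier),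
      f (FUSpace.tmul h X ⟨m, mem_bimodU hm⟩ x) (FUSpace.tmul h X ⟨n, mem_bimodU hn⟩ y) ∈ R)
    (x y : FUSpace h X) : f x y ∈ R := by
  let L₁ : FUSpace h X → FUSpace h X →L[ℂ] D := fun y => LinearMap.mkContinuous
    { toFun := fun x => f x y
      map_add' := fun x x' => hadd x x' y
      map_smul' := fun a x => hsmul a x y } ‖y‖
    fun x => (hf x y).trans_eq (mul_comm _ _)
  let L₂ : FUSpace h X → FUSpace h X →L⋆[ℂ] D := fun x => LinearMap.mkContinuous
    { toFun := fun y => f x y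
      map_add' := hadd' x
      map_smul' := fun a y => hsmul' a x y } ‖x‖ (hf x)
  refine FUSpace.mem_of_tmul_mem (p := R.comap (L₂ x).toLinearMap)
    (hR.preimage (L₂ x).continuous) (fun n hn y' => ?_) y
  exact FUSpace.mem_of_tmul_mem (p := R.comap (L₁ _).toLinearMap)
    (hR.preimage (L₁ _).continuous) (fun m hm x' => hmem m hm n hn x' y') x

theorem isClosed_range_valIsometry (h : IsTROEquivalence A B M) :
    IsClosed[wstarTopology K₀ K₀]
      (LinearMap.range (valIsometry B).toLinearMap : Set (K₀ →L[ℂ] K₀)) := by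
  have h1 : (LinearMap.range (valIsometry B).toLinearMap : Set (K₀ →L[ℂ] K₀)) = B :=
    Subtype.range_coe
  rw [h1]
  exact h.isClosed_right

theorem repFunctional_mem (h : IsTROEquivalence A B M) (X : NormalRep A) (x y : FUSpace h X) :
    repFunctional h X x y ∈ wstarDual (valIsometry B) := by
  refine FUSpace.sesquilinear_mem (isClosed_wstarDual _ (isClosed_range_valIsometry h))
    (repFunctional h X) (fun x x' y => ?_) (fun a x y => ?_) (fun x y y' => ?_)
    (fun a x y => ?_) (norm_repFunctional_le h X) (fun m hm n hn x y => ?_) x y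
  · refine ContinuousLinearMap.ext fun b => ?_
    rw [add_apply, repFunctional_apply, map_add, inner_add_right]
    rfl
  · refine ContinuousLinearMap.ext fun b => ?_
    rw [smul_apply, repFunctional_apply, map_smul, inner_smul_right]
    rfl
  · refine ContinuousLinearMap.ext fun b => ?_
    rw [add_apply, repFunctional_apply, inner_add_left]
    rfl
  · refine ContinuousLinearMap.ext fun b => ?_
    rw [smul_apply, repFunctional_apply, inner_smul_left]
    rfl
  · rw [mem_wstarDual]
    have e : ⇑(repFunctional h X (FUSpace.tmul h X ⟨m, mem_bimodU hm⟩ x)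
        (FUSpace.tmul h X ⟨n, mem_bimodU hn⟩ y)) = fun b : B =>
        ⟪y, X.rep ⟨ContinuousLinearMap.adjoint n ∘L
          (mulU b (⟨m, mem_bimodU hm⟩ : bimodU B M) : H₀ →L[ℂ] K₀),
          h.comp_mem (adjoint_mem_bimodV hn) (mulU b ⟨m, mem_bimodU hm⟩).2⟩ x⟫_ℂ := by
      funext b
      change B at b
      change ⟪_, actCLM h X b _⟫_ℂ = _
      rw [actCLM_tmul, inner_tmul_left h X hn, evalV_tmul]
    rw [e]
    exact continuous_coeff h X ⟨ContinuousLinearMap.adjoint n, adjoint_mem_bimodV hn⟩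
      ⟨m, mem_bimodU hm⟩ x y

theorem actRep_wstarContinuous (h : IsTROEquivalence A B M) (X : NormalRep A) :
    IsWStarContinuous (actRep h X) := by
  have key : ∀ p : SqSummablePair (FUSpace h X) (FUSpace h X),
      Continuous[TopologicalSpace.induced Subtype.val (wstarTopology K₀ K₀), inferInstance]
        fun b : B => ∑' n, repFunctional h X (p.1.1 n) (p.1.2 n) b := fun p => by
    refine continuous_tsum_of_mem_wstarDual (valIsometry B) (isClosed_range_valIsometry h)
      (fun n => repFunctional_mem h X _ _) ?_
    refine Summable.of_norm_bounded (g := fun n => ‖p.1.1 n‖ ^ 2 + ‖p.1.2 n‖ ^ 2)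
      (p.2.1.add p.2.2) fun n => (norm_repFunctional_le h X _ _).trans ?_
    nlinarith [sq_nonneg (‖p.1.1 n‖ - ‖p.1.2 n‖), sq_nonneg ‖p.1.1 n‖, sq_nonneg ‖p.1.2 n‖]
  let : TopologicalSpace B := TopologicalSpace.induced Subtype.val (wstarTopology K₀ K₀)
  exact continuous_induced_rng.2 (continuous_pi key)

/-- `F_U` is well defined: each `F_U(H)` is a Hilbert space on which `β` is a normal
representation. -/
theorem IsTROEquivalence.wellDefined (h : IsTROEquivalence A B M) : FUWellDefined h where
  parallelogram X := FUSpace.innerProductSpaceable h X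
  completelyContractive X := actRep_completelyContractive h X
  wstarContinuous X := actRep_wstarContinuous h X

end TRO

section TRO

open Filter CategoryTheory

variable {H₀ K₀ : Type u}
  [NormedAddCommGroup H₀] [InnerProductSpace ℂ H₀] [CompleteSpace H₀]
  [NormedAddCommGroup K₀] [InnerProductSpace ℂ K₀] [CompleteSpace K₀]
  {A : Subalgebra ℂ (H₀ →L[ℂ] H₀)} {B : Subalgebra ℂ (K₀ →L[ℂ] K₀)}
  {M : Submodule ℂ (H₀ →L[ℂ] K₀)}

/-! ### The Δ-extension of `F_U` -/

/-- The algebraic tensor product `M ⊗ H`. -/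
def TensorM (M : Submodule ℂ (H₀ →L[ℂ] K₀)) (X : NormalRep A) : Type u := M ⊗[ℂ] X.carrier

instance (X : NormalRep A) : AddCommGroup (TensorM M X) :=
  inferInstanceAs (AddCommGroup (M ⊗[ℂ] X.carrier))

instance (X : NormalRep A) : Module ℂ (TensorM M X) :=
  inferInstanceAs (Module ℂ (M ⊗[ℂ] X.carrier))

/-- The map `M ⊗ H → F_U(H)`. -/
def tmulM (h : IsTROEquivalence A B M) (X : NormalRep A) : TensorM M X →ₗ[ℂ] FUSpace h X :=
  show M ⊗[ℂ] X.carrier →ₗ[ℂ] FUSpace h X from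
  (UniformSpace.Completion.toComplL (𝕜 := ℂ) (E := PreFU h X)).toLinearMap ∘ₗ
    (show M ⊗[ℂ] X.carrier →ₗ[ℂ] (bimodU B M) ⊗[ℂ] X.carrier from
      (Submodule.inclusion (fun _ hm => mem_bimodU hm : M ≤ bimodU B M)).rTensor X.carrier)

theorem denseRange_tmulM (h : IsTROEquivalence A B M) (X : NormalRep A) :
    DenseRange (tmulM h X) := by
  intro z
  exact FUSpace.mem_of_tmul_mem (p := (LinearMap.range (tmulM h X)).topologicalClosure)
    (Submodule.isClosed_topologicalClosure _) (fun m hm x =>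
      Submodule.le_topologicalClosure _
        ⟨show M ⊗[ℂ] X.carrier from (⟨m, hm⟩ : M) ⊗ₜ x, rfl⟩) z

/-- `M* B M`, for `b` in the diagonal of `B`, lies in the diagonal of `A`. -/
theorem IsTROEquivalence.adjoint_mul_mem_diagonal (h : IsTROEquivalence A B M)
    {m n : H₀ →L[ℂ] K₀} (hm : m ∈ M) (hn : n ∈ M) {b : K₀ →L[ℂ] K₀} (hb : b ∈ diagonal B) :
    ContinuousLinearMap.adjoint m ∘L b ∘L n ∈ diagonal A := by
  refine ⟨h.comp_mem (adjoint_mem_bimodV hm) (comp_mem_bimodU hb.1 (mem_bimodU hn)), ?_⟩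
  have e : star (ContinuousLinearMap.adjoint m ∘L b ∘L n) =
      ContinuousLinearMap.adjoint n ∘L star b ∘L m := by
    simp only [ContinuousLinearMap.star_eq_adjoint, ContinuousLinearMap.adjoint_comp,
      ContinuousLinearMap.adjoint_adjoint, ContinuousLinearMap.comp_assoc]
  rw [e]
  exact h.comp_mem (adjoint_mem_bimodV hn) (comp_mem_bimodU hb.2 (mem_bimodU hm))

/-- `α₂(m* n) f = f α₁(m* n)` for a `Δ(A)`-module map `f`. -/
theorem NormalRep.DHom.apply_rep (h : IsTROEquivalence A B M) {X Y : NormalRep A}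
    (f : NormalRep.DHom X Y) {m n : H₀ →L[ℂ] K₀} (hm : m ∈ M) (hn : n ∈ M) {b : K₀ →L[ℂ] K₀}
    (hb : b ∈ diagonal B) (hmem : ContinuousLinearMap.adjoint m ∘L b ∘L n ∈ A) (x : X.carrier) :
    f.toCLM (X.rep ⟨ContinuousLinearMap.adjoint m ∘L b ∘L n, hmem⟩ x) =
      Y.rep ⟨ContinuousLinearMap.adjoint m ∘L b ∘L n, hmem⟩ (f.toCLM x) :=
  DFunLike.congr_fun (f.comm _ (h.adjoint_mul_mem_diagonal hm hn hb)) x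

theorem one_mem_diagonal (B : Subalgebra ℂ (K₀ →L[ℂ] K₀)) : (1 : K₀ →L[ℂ] K₀) ∈ diagonal B :=
  ⟨B.one_mem, by rw [star_one]; exact B.one_mem⟩

/-- The map `m ⊗ x ↦ m ⊗ f(x)` on the algebraic tensor products. -/
def tensorMap (M : Submodule ℂ (H₀ →L[ℂ] K₀)) {X Y : NormalRep A} (f : NormalRep.DHom X Y) :
    TensorM M X →ₗ[ℂ] TensorM M Y :=
  show M ⊗[ℂ] X.carrier →ₗ[ℂ] M ⊗[ℂ] Y.carrier from f.toCLM.toLinearMap.lTensor M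

theorem colComp_tmulM_tensorMap (h : IsTROEquivalence A B M) {X Y : NormalRep A}
    (f : NormalRep.DHom X Y) (s : ColFamily M) (k : Fin s.1) (z : TensorM M X) :
    colComp h Y s k (tmulM h Y (tensorMap M f z)) = f.toCLM (colComp h X s k (tmulM h X z)) := by
  have : (show M ⊗[ℂ] X.carrier →ₗ[ℂ] Y.carrier from
      (colComp h Y s k).toLinearMap ∘ₗ tmulM h Y ∘ₗ tensorMap M f) =
      (show M ⊗[ℂ] X.carrier →ₗ[ℂ] Y.carrier from
        f.toCLM.toLinearMap ∘ₗ (colComp h X s k).toLinearMap ∘ₗ tmulM h X) :=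
    TensorProduct.ext' fun m x => by
      change evalV h Y _ (FUSpace.tmul h Y ⟨m, mem_bimodU m.2⟩ (f.toCLM x)) =
        f.toCLM (evalV h X _ (FUSpace.tmul h X ⟨m, mem_bimodU m.2⟩ x))
      rw [evalV_tmul, evalV_tmul]
      exact (f.apply_rep h (s.op_mem k) m.2 (one_mem_diagonal B) _ x).symm
  exact LinearMap.congr_fun this z

theorem norm_tmulM_tensorMap_le (h : IsTROEquivalence A B M) {X Y : NormalRep A}
    (f : NormalRep.DHom X Y) (z : TensorM M X) :
    ‖tmulM h Y (tensorMap M f z)‖ ≤ ‖f.toCLM‖ * ‖tmulM h X z‖ := by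
  have := h.unitFilter_neBot
  refine le_of_tendsto' (tendsto_norm_colMap h Y _) fun s => ?_
  refine le_trans ?_ (mul_le_mul_of_nonneg_left (norm_colMap_le h X s _) (norm_nonneg _))
  refine le_of_sq_le_sq ?_ (by positivity)
  rw [mul_pow, norm_colMap_sq, norm_colMap_sq, Finset.mul_sum]
  refine Finset.sum_le_sum fun k _ => ?_
  rw [colComp_tmulM_tensorMap, ← mul_pow]
  exact pow_le_pow_left₀ (norm_nonneg _) (f.toCLM.le_opNorm _) 2

/-- The operator `F_U(X) → F_U(Y)`, `m ⊗ x ↦ m ⊗ f(x)`, for a `Δ(A)`-module map `f`. -/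
def deltaMap (h : IsTROEquivalence A B M) {X Y : NormalRep A} (f : NormalRep.DHom X Y) :
    FUSpace h X →L[ℂ] FUSpace h Y :=
  LinearMap.extendOfNorm (tmulM h Y ∘ₗ tensorMap M f) (tmulM h X)

theorem deltaMap_tmul (h : IsTROEquivalence A B M) {X Y : NormalRep A} (f : NormalRep.DHom X Y)
    {m : H₀ →L[ℂ] K₀} (hm : m ∈ M) (x : X.carrier) :
    deltaMap h f (FUSpace.tmul h X ⟨m, mem_bimodU hm⟩ x) =
      FUSpace.tmul h Y ⟨m, mem_bimodU hm⟩ (f.toCLM x) := by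
  have h1 : ∀ z, deltaMap h f (tmulM h X z) = tmulM h Y (tensorMap M f z) := fun z =>
    LinearMap.extendOfNorm_eq (f := tmulM h Y ∘ₗ tensorMap M f) (denseRange_tmulM h X)
      ⟨‖f.toCLM‖, norm_tmulM_tensorMap_le h f⟩ z
  exact h1 (show M ⊗[ℂ] X.carrier from (⟨m, hm⟩ : M) ⊗ₜ x)

theorem inner_deltaMap_adjoint (h : IsTROEquivalence A B M) {X Y : NormalRep A}
    (f : NormalRep.DHom X Y) (w : FUSpace h Y) (z : FUSpace h X) :
    ⟪deltaMap h f.adjoint w, z⟫_ℂ = ⟪w, deltaMap h f z⟫_ℂ := by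
  have h1 : deltaMap h f.adjoint = ContinuousLinearMap.adjoint (deltaMap h f) :=
    FUSpace.hom_ext_mem fun n hn y => by
      refine ext_inner_right ℂ fun z => ?_
      rw [ContinuousLinearMap.adjoint_inner_left]
      suffices hs : innerSL ℂ (deltaMap h f.adjoint (FUSpace.tmul h Y ⟨n, mem_bimodU hn⟩ y)) =
          innerSL ℂ (FUSpace.tmul h Y ⟨n, mem_bimodU hn⟩ y) ∘L deltaMap h f from
        DFunLike.congr_fun hs z
      refine FUSpace.hom_ext_mem fun m hm x => ?_
      rw [ContinuousLinearMap.comp_apply, innerSL_apply_apply, innerSL_apply_apply,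
        deltaMap_tmul h _ hn, deltaMap_tmul h _ hm, inner_tmul_left h X hn,
        inner_tmul_left h Y hn, evalV_tmul, evalV_tmul]
      change ⟪ContinuousLinearMap.adjoint f.toCLM y, _⟫_ℂ = _
      rw [ContinuousLinearMap.adjoint_inner_left]
      exact congrArg _ (f.apply_rep h hn hm (one_mem_diagonal B) _ x)
  rw [h1, ContinuousLinearMap.adjoint_inner_left]

theorem deltaMap_adjoint (h : IsTROEquivalence A B M) {X Y : NormalRep A}
    (f : NormalRep.DHom X Y) :
    deltaMap h f.adjoint = ContinuousLinearMap.adjoint (deltaMap h f) :=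
  ContinuousLinearMap.ext fun w => ext_inner_right ℂ fun z => by
    rw [inner_deltaMap_adjoint, ContinuousLinearMap.adjoint_inner_left]

theorem deltaMap_actCLM (h : IsTROEquivalence A B M) {X Y : NormalRep A} (f : NormalRep.DHom X Y)
    (b : B) (hb : (b : K₀ →L[ℂ] K₀) ∈ diagonal B) :
    deltaMap h f ∘L actCLM h X b = actCLM h Y b ∘L deltaMap h f :=
  FUSpace.hom_ext_mem fun m hm x => by
    rw [ContinuousLinearMap.comp_apply, ContinuousLinearMap.comp_apply]
    refine (innerSL_inj (𝕜 := ℂ)).1 (FUSpace.hom_ext_mem fun n hn y => ?_)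
    rw [innerSL_apply_apply, innerSL_apply_apply, ← inner_conj_symm,
      ← inner_conj_symm (actCLM h Y b _)]
    congr 1
    rw [← inner_deltaMap_adjoint, deltaMap_tmul h _ hn, deltaMap_tmul h _ hm, actCLM_tmul,
      actCLM_tmul, inner_tmul_left h X hn, inner_tmul_left h Y hn, evalV_tmul, evalV_tmul]
    change ⟪ContinuousLinearMap.adjoint f.toCLM y, _⟫_ℂ = _
    rw [ContinuousLinearMap.adjoint_inner_left]
    exact congrArg _ (f.apply_rep h hn hm hb _ x)

/-- The Δ-extension of `F_U`. -/
def deltaFunctor (h : IsTROEquivalence A B M) :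
    CategoryTheory.Functor (DNormalRep A) (DNormalRep B) where
  obj X := ⟨FUObj h.wellDefined X.obj⟩
  map f := ⟨deltaMap h f, fun b hb => deltaMap_actCLM h f b hb⟩
  map_id X := NormalRep.DHom.ext (FUSpace.hom_ext_mem fun m hm x => deltaMap_tmul h _ hm x)
  map_comp {X Y Z} f g := NormalRep.DHom.ext (FUSpace.hom_ext_mem fun m hm x => by
    change deltaMap h _ _ = deltaMap h g (deltaMap h f _)
    rw [deltaMap_tmul h _ hm, deltaMap_tmul h _ hm, deltaMap_tmul h _ hm]
    rfl)

theorem deltaFunctor_isDeltaExtension (h : IsTROEquivalence A B M) :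
    IsDeltaExtension (FU h.wellDefined) (deltaFunctor h) := by
  refine CategoryTheory.Functor.hext (fun X => rfl) fun X Y f => heq_of_eq ?_
  refine NormalRep.DHom.ext (FUSpace.hom_ext_mem fun m hm x => ?_)
  exact (deltaMap_tmul h _ hm x).trans (mapCLM_tmul h f _ x).symm

theorem deltaFunctor_isStarFunctor (h : IsTROEquivalence A B M) :
    IsStarFunctor (deltaFunctor h) :=
  fun _ _ f => NormalRep.DHom.ext (deltaMap_adjoint h f)

theorem deltaFunctor_mapCLM (h : IsTROEquivalence A B M)
    (hG : IsDeltaExtension (FU h.wellDefined) (deltaFunctor h)) {X Y : DNormalRep A}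
    (f : X ⟶ Y) : hG.mapCLM f = deltaMap h f := by
  rfl

end TRO

end DualOpAlg

end


open CategoryTheory DualOpAlg in
theorem theorem4p3 {H₀ K₀ : Type u}
    [NormedAddCommGroup H₀] [InnerProductSpace ℂ H₀] [CompleteSpace H₀]
    [NormedAddCommGroup K₀] [InnerProductSpace ℂ K₀] [CompleteSpace K₀]
    (A : Subalgebra ℂ (H₀ →L[ℂ] H₀)) (B : Subalgebra ℂ (K₀ →L[ℂ] K₀))
    (M : Submodule ℂ (H₀ →L[ℂ] K₀)) (h : IsTROEquivalence A B M) :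
    ∃ (w : FUWellDefined h) (G : DNormalRep A ⥤ DNormalRep B)
      (hG : IsDeltaExtension (FU w) G),
      (∀ (X Y : DNormalRep A) (f : X ⟶ Y) (m : H₀ →L[ℂ] K₀) (hm : m ∈ M) (x : X.obj.carrier),
        hG.mapCLM f (FUSpace.tmul h X.obj ⟨m, mem_bimodU hm⟩ x) =
          FUSpace.tmul h Y.obj ⟨m, mem_bimodU hm⟩ (NormalRep.DHom.toCLM f x)) ∧
      IsStarFunctor G := by
  refine ⟨h.wellDefined, deltaFunctor h, deltaFunctor_isDeltaExtension h,
    fun X Y f m hm x => ?_, deltaFunctor_isStarFunctor h⟩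
  rw [deltaFunctor_mapCLM]
  exact deltaMap_tmul h f hm x
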